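/- Let $R$ be a ring with identity whose additive group carries a locally compact second countable Hausdorff group topology, and let $|\cdot|$ be a Haar measure on $(R,+)$. Let $G$ be a locally compact second countable Hausdorff abelian group with identity $e$ that is a (unital) $R$-module with continuous scalar multiplication $R\times G\to G$, $(t,g)\mapsto g^t$. Let $(X,\mathscr X,\mu)$ be a standard Borel probability space on which $G$ acts jointly measurably and preserving $\mu$; write $g\phi=\phi\circ g$ for functions $\phi$ on $X$. Let $\mathscr X'\subseteq\mathscr X$ be a $G$-invariant sub-$\sigma$-algebra, $\mathcal X'=(X,\mathscr X',\mu,G)$, and let $\pi\colon\mathcal X'\to\mathcal Y=(Y,\mathscr Y,\nu,G)$ be a factor map: $\mathcal Y$ is a probability space with a $\nu$-preserving measurable action of $G$, $\pi\colon X\to Y$ is $\mathscr X'$-measurable, $\pi_*\mu=\nu$, and for every $g\in G$ one has $\pi(gx)=g\pi(x)$ for $\mu$-a.e. $x$. Let $\mu=\int_Y\mu_y\,d\nu(y)$ be the disintegration of $\mu$ over $\mathcal Y$ and let $\mu\otimes_{\mathcal Y}\mu=\int_Y\mu_y\times\mu_y\,d\nu(y)$ on $X\times X$. The extension $\pi\colon\mathcal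 X'\to\mathcal Y$ is called *totally relatively weak-mixing for $G$* if for every $g\in G$ with $g\ne e$, every $H\in L^2(X\times X,\mathscr X'\otimes\mathscr X',\mu\otimes_{\mathcal Y}\mu)$ that is invariant under the diagonal action of the $R$-submodule $\langle g\rangle_R$ generated by $g$ is a function on $Y$, i.e. $H(x_1,x_2)=h(\pi(x_1))$ for $\mu\otimes_{\mathcal Y}\mu$-a.e. $(x_1,x_2)$, for some measurable $h$ on $Y$. A *weak Følner sequence* in $(R,+)$ is a sequence $\{F_n\}_{n\ge1}$ of compact subsets of $R$ of positive Haar measure such that $\lim_{n\to\infty}|(r+F_n)\,\triangle\,F_n|/|F_n|=0$ for every $r\in R$. A Borel measurable map $t\mapsto x_t$ from $R$ to a topological space *converges in density over $\{F_n\}$* to a point $x$, written $\mathrm{D}\text{-}\lim_{t\in R}x_t=x$, if for every neighborhood $V$ of $x$, $\limsup_{n\to\infty}|\{t\in F_n: x_t\notin V\}|/|F_n|=0$. **Proposition 3.7.** Let $\pi\colon\mathcal X'\to\mathcal Y$ be totally relatively weak-mixing for $G$, let $T_1,\dots,T_l\in G$ be distinct with $T_i\neq e$ for $1\le i\le l$,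 and let $f_1,\dots,f_l\in L^\infty(X,\mathscr X',\mu)$ (complex-valued). Then, over every weak Følner sequence in $(R,+)$, $$\mathrm{D}\text{-}\lim_{t\in R}\Bigl\{\prod_{i=1}^l T_i^tf_i-\prod_{i=1}^l T_i^tE_\mu\bigl(f_i\mid\pi^{-1}[\mathscr Y]\bigr)\Bigr\}=0$$ in $L^2(X,\mathscr X',\mu)$ with the weak topology. In particular, the map of $t$ in braces takes values in $L^2(X,\mathscr X',\mu)$ and is Borel measurable. -/

import Mathlib

open MeasureTheory ProbabilityTheory Filter Topology

/-- A weak Følner sequence in `(R, +)` with respect to the Haar measure `lam`: compact sets of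
positive Haar measure with `|(r + Fₙ) ∆ Fₙ| / |Fₙ| → 0` for every single `r`. -/
structure IsWeakFolner {R : Type*} [AddCommGroup R] [TopologicalSpace R] [MeasurableSpace R]
    (lam : Measure R) (F : ℕ → Set R) : Prop where
  isCompact : ∀ n, IsCompact (F n)
  measure_pos : ∀ n, 0 < lam (F n)
  tendsto_symmDiff : ∀ r : R,
    Tendsto (fun n => lam (symmDiff ((fun t => r + t) '' F n) (F n)) / lam (F n)) atTop (𝓝 0)

/-- The upper density of `S` over `F`: `limsup |S ∩ Fₙ| / |Fₙ|`. -/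
noncomputable def upperDensity {R : Type*} [MeasurableSpace R]
    (lam : Measure R) (F : ℕ → Set R) (S : Set R) : ENNReal :=
  limsup (fun n => lam (S ∩ F n) / lam (F n)) atTop

/-- The Borel measurable function `x : R → E` converges to `a` in density over `F`: for every
neighbourhood `V` of `a`, one has `x t ∈ V` except for a set of `t` of density `0` over `F`. -/
structure ConvergesInDensity {R E : Type*} [MeasurableSpace R] [TopologicalSpace E]
    (lam : Measure R) (F : ℕ → Set R) (x : R → E) (a : E) : Prop where
  borel_measurable : Measurable[_, borel E] x
  density_zero : ∀ V ∈ 𝓝 a, upperDensity lam F {t | x t ∉ V} = 0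

/-- The relative product `μ ×_Y μ = ∫ μ_y × μ_y dν(y)` on `X × X`, where `ν` is the image of `μ`
under `π : X → Y` and `μ = ∫ μ_y dν(y)` is the disintegration of `μ` over `Y`, the kernel
`y ↦ μ_y` being the regular conditional distribution on the standard Borel space `X` given `π`. -/
noncomputable def relativeProduct {X Y : Type*} [MeasurableSpace X] [StandardBorelSpace X]
    [Nonempty X] [MeasurableSpace Y] (μ : Measure X) [IsFiniteMeasure μ] (π : X → Y) :
    Measure (X × X) :=
  (μ.map π).bind (condDistrib id π μ ×ₖ condDistrib id π μ)

/-- `π : (X, 𝒳', μ, G) → (Y, 𝒴, ν, G)` is a factor map, where `𝒳'` is a `G`-invariant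
sub-σ-algebra of the σ-algebra `𝒳` of `X`. -/
structure IsFactorMap (G : Type*) {X Y : Type*} (𝒳' : MeasurableSpace X) [𝒳 : MeasurableSpace X]
    [MeasurableSpace Y] [VAdd G X] [VAdd G Y] (μ : Measure X) (ν : Measure Y) (π : X → Y) :
    Prop where
  le : 𝒳' ≤ 𝒳
  invariant : ∀ g : G, Measurable[𝒳', 𝒳'] fun x : X => g +ᵥ x
  measurable : Measurable[𝒳'] π
  map_eq : μ.map π = ν
  equivariant : ∀ g : G, ∀ᵐ x ∂μ, π (g +ᵥ x) = g +ᵥ π x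

/-- `π : (X, 𝒳', μ, G) → Y` is relatively weak-mixing for `g ∈ G`: every `H` in
`L²(X × X, 𝒳' ⊗ 𝒳', μ ×_Y μ)` that is invariant under the `R`-submodule generated by `g`
(acting diagonally) is a function on `Y`. -/
def IsRelativelyWeakMixingFor (R : Type*) {G X Y : Type*} [Ring R] [AddCommGroup G] [Module R G]
    (𝒳' : MeasurableSpace X) [MeasurableSpace X] [StandardBorelSpace X] [Nonempty X]
    [MeasurableSpace Y] [AddAction G X] (μ : Measure X) [IsFiniteMeasure μ] (π : X → Y) (g : G) :
    Prop :=
  ∀ H : X × X → ℂ, MemLp H 2 (relativeProduct μ π) →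
    AEStronglyMeasurable[𝒳'.prod 𝒳'] H (relativeProduct μ π) →
    (∀ h ∈ Submodule.span R {g},
      (fun p : X × X => H (h +ᵥ p.1, h +ᵥ p.2)) =ᵐ[relativeProduct μ π] H) →
    ∃ φ : Y → ℂ, Measurable φ ∧ H =ᵐ[relativeProduct μ π] fun p => φ (π p.1)

/-- `π : (X, 𝒳', μ, G) → Y` is totally relatively weak-mixing for `Γ ⊆ G`. -/
def IsTotallyRelativelyWeakMixing (R : Type*) {G X Y : Type*} [Ring R] [AddCommGroup G]
    [Module R G] (𝒳' : MeasurableSpace X) [MeasurableSpace X] [StandardBorelSpace X] [Nonempty X]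
    [MeasurableSpace Y] [AddAction G X] (μ : Measure X) [IsFiniteMeasure μ] (π : X → Y)
    (Γ : Set G) : Prop :=
  ∀ g ∈ Γ, g ≠ 0 → IsRelativelyWeakMixingFor R 𝒳' μ π g

/-!
Write `x t` for the product `∏ Tᵢᵗ fᵢ` in `L²(μ)` and `E` for the conditional expectation on the
factor. Replacing the `fᵢ` by `E fᵢ` one at a time (`hasRelativelyIndependentTranslates_of_tendsto`)
reduces the claim to products in which some `E f_j = 0`; those must tend weakly to `0` on average,
which by Chebyshev's inequality is the same as convergence in density.

This is proved by van der Corput's method and induction on the number `l` of factors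
(`tendsto_average_translateProd`). For weights `w` of total mass `1` and shifts `r₁, …, r_k` in `R`,
asymptotic invariance of the averages and a Bessel-type inequality bound the average of `|⟨φ, x t⟩|`
by `‖φ‖` times the square root of `∑ w_a w_b |⟨x (t + r_a), x (t + r_b)⟩|`, averaged over `t`
(`tendsto_average_norm_inner`). Since the action preserves `μ`, each inner product is the integral
of a fixed function times a product of `l - 1` translates, by the distinct non-zero elements
`t • (T_i - T_j)`, of the functions `conj (r_a T_i f_i) * (r_b T_i f_i)`. By induction these may be
replaced by their conditional expectations, and the fixed function then by its own; what remains is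
bounded by the size of `E (conj (r_a T_j f_j) * (r_b T_j f_j))`
(`norm_integral_conj_translateProd_mul_le`).

The squared `L²` norm of that function is the inner product of the translates of
`Φ = f_j ⊗ conj f_j` by `r_a • T_j` and `r_b • T_j` in `L²` of the relative product, so the weighted
double sum of these quantities is the squared norm of a convex combination of the orbit of `Φ`.
Relative weak mixing for `T_j` says that the invariant functions come from the factor, and
`E f_j = 0` makes `Φ` orthogonal to them. The element of least norm in the closed convex hull of the
orbit is invariant, hence `0`, and the weights and shifts can be chosen to make the sum small
(`exists_convex_combination_orbit_norm_lt`, `IsRelativelyWeakMixingFor.exists_weights`). Working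
with finite convex combinations instead of Følner averages over `R` in the relative product keeps
all measurability questions in the single variable `t`.
-/

/-! ### Averaging over the fibres of a factor map -/

section Preliminaries

variable {X : Type*} [MeasurableSpace X] {μ : Measure X}

theorem integrable_of_bounded [IsFiniteMeasure μ] {f : X → ℂ} {C : ℝ} (hf : Measurable f)
    (hC : ∀ x, ‖f x‖ ≤ C) : Integrable f μ :=
  .of_bound hf.aestronglyMeasurable C (ae_of_all _ hC)

theorem integral_vadd_eq {G : Type*} [AddGroup G] [AddAction G X] [MeasurableConstVAdd G X]
    [VAddInvariantMeasure G X μ] (g : G) (h : X → ℂ) :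
    ∫ x, h (g +ᵥ x) ∂μ = ∫ x, h x ∂μ :=
  (measurePreserving_vadd g μ).integral_comp (measurableEmbedding_const_vadd g) h

/-- If `h` is a function of `π`, then so is each translate of `h`, up to null sets. -/
theorem aestronglyMeasurable_comap_vadd {Y : Type*} [𝒴 : MeasurableSpace Y] {π : X → Y}
    {G : Type*} [VAdd G X] [VAdd G Y] [MeasurableConstVAdd G Y] (g : G)
    (hg : ∀ᵐ x ∂μ, π (g +ᵥ x) = g +ᵥ π x)
    {k : Y → ℂ} (hk : Measurable k) :
    AEStronglyMeasurable[𝒴.comap π] (fun ω => k (π (g +ᵥ ω))) μ := by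
  refine ⟨fun ω => k (g +ᵥ π ω), ?_, ?_⟩
  · exact Measurable.stronglyMeasurable
      ((hk.comp (measurable_const_vadd g)).comp (comap_measurable π))
  · filter_upwards [hg] with ω hω
    rw [hω]

end Preliminaries

section CondMean

variable {X Y : Type*} [𝒳 : MeasurableSpace X] [StandardBorelSpace X] [Nonempty X]
  [𝒴 : MeasurableSpace Y]

/-- The conditional expectation of `f` given `π`, in the version `ω ↦ ∫ f dμ_{π ω}` provided by the
disintegration of `μ`. Unlike `μ[f | 𝒴.comap π]` it is bounded everywhere when `f` is. -/
noncomputable def condMean (μ : Measure X) [IsFiniteMeasure μ] (π : X → Y) (f : X → ℂ) (ω : X) :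
    ℂ :=
  ∫ x, f x ∂condDistrib id π μ (π ω)

variable {μ : Measure X} [IsProbabilityMeasure μ] {π : X → Y} {f : X → ℂ} {C : ℝ}

theorem measurable_integral_condDistrib_id (hf : Measurable f) :
    Measurable fun y : Y => ∫ x, f x ∂condDistrib id π μ y :=
  (hf.stronglyMeasurable.comp_measurable measurable_snd).integral_condDistrib.measurable

theorem measurable_condMean (hf : Measurable f) :
    Measurable[𝒴.comap π] (condMean μ π f) :=
  (measurable_integral_condDistrib_id hf).comp (comap_measurable π)

theorem norm_condMean_le (hC : ∀ x, ‖f x‖ ≤ C) (ω : X) : ‖condMean μ π f ω‖ ≤ C := by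
  have := norm_integral_le_of_norm_le_const (μ := condDistrib id π μ (π ω)) (ae_of_all _ hC)
  simpa [condMean] using this

theorem condMean_ae_eq (hπ : Measurable π) (hf : Integrable f μ) :
    condMean μ π f =ᵐ[μ] μ[f | 𝒴.comap π] :=
  (condExp_ae_eq_integral_condDistrib_id hπ hf).symm

theorem integral_mul_condMean (hπ : Measurable π) (hf : Integrable f μ) {h : X → ℂ}
    (hh : AEStronglyMeasurable[𝒴.comap π] h μ) (hC : ∀ x, ‖h x‖ ≤ C) :
    ∫ ω, h ω * condMean μ π f ω ∂μ = ∫ ω, h ω * f ω ∂μ := by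
  have hm : 𝒴.comap π ≤ 𝒳 := hπ.comap_le
  have h1 := condExp_aestronglyMeasurable_bilin_of_bound (ContinuousLinearMap.mul ℝ ℂ) hm hh hf C
    (ae_of_all _ hC)
  rw [← integral_condExp hm (f := fun ω => h ω * f ω)]
  refine integral_congr_ae ?_
  filter_upwards [h1, condMean_ae_eq hπ hf] with ω h1 h2
  simpa [h2] using h1.symm

theorem condMean_sub_condMean (hπ : Measurable π) (hf : Measurable f)
    (hC : ∀ x, ‖f x‖ ≤ C) : condMean μ π (fun x => f x - condMean μ π f x) =ᵐ[μ] 0 := by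
  have hm := hπ.comap_le
  have hE : Measurable[𝒴.comap π] (condMean μ π f) := measurable_condMean hf
  have hfi : Integrable f μ := integrable_of_bounded hf hC
  have hEi : Integrable (condMean μ π f) μ :=
    integrable_of_bounded (hE.mono hm le_rfl) (norm_condMean_le hC)
  have h1 := condMean_ae_eq (μ := μ) hπ (hfi.sub hEi)
  have h2 := condExp_sub hfi hEi (𝒴.comap π)
  rw [condExp_of_stronglyMeasurable hm hE.stronglyMeasurable hEi] at h2
  filter_upwards [h1, h2, condMean_ae_eq (μ := μ) hπ hfi] with ω h1 h2 h3
  rw [Pi.sub_apply, ← h3, sub_self] at h2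
  exact h1.trans h2

variable {G : Type*} [AddGroup G] [AddAction G X] [MeasurableConstVAdd G X]
  [VAddInvariantMeasure G X μ] [AddAction G Y] [MeasurableConstVAdd G Y]

theorem condMean_vadd (hπ : Measurable π) (hg : ∀ g : G, ∀ᵐ x ∂μ, π (g +ᵥ x) = g +ᵥ π x)
    (hf : Measurable f) (hC : ∀ x, ‖f x‖ ≤ C) (g : G) :
    (fun ω => condMean μ π f (g +ᵥ ω)) =ᵐ[μ] condMean μ π fun ω => f (g +ᵥ ω) := by
  have hfg : Measurable fun ω => f (g +ᵥ ω) := hf.comp (measurable_const_vadd g)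
  have hfi : Integrable (fun ω => f (g +ᵥ ω)) μ := integrable_of_bounded hfg fun x => hC _
  refine EventuallyEq.trans ?_ (condMean_ae_eq hπ hfi).symm
  have hEm : Measurable (condMean μ π f) := (measurable_condMean hf).mono hπ.comap_le le_rfl
  refine ae_eq_condExp_of_forall_setIntegral_eq hπ.comap_le hfi (fun s _ _ => ?_) ?_ ?_
  · exact (integrable_of_bounded (hEm.comp (measurable_const_vadd g))
      fun x => norm_condMean_le hC _).integrableOn
  · rintro _ ⟨B, hB, rfl⟩ -
    -- Both integrals are moved by `-g`, which takes `π⁻¹ B` to `π⁻¹ (g +ᵥ B)` up to a null set.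
    have key : ∀ u : X → ℂ, ∫ x in π ⁻¹' B, u (g +ᵥ x) ∂μ =
        ∫ x, (π ⁻¹' {y | -g +ᵥ y ∈ B}).indicator 1 x * u x ∂μ := fun u => by
      rw [← integral_indicator (hπ hB), ← integral_vadd_eq (μ := μ) g
        fun x => (π ⁻¹' {y | -g +ᵥ y ∈ B}).indicator 1 x * u x]
      refine integral_congr_ae ?_
      filter_upwards [hg g] with x hx
      by_cases h : π x ∈ B <;> simp [Set.indicator, hx, h]
    have hB' : MeasurableSet {y : Y | -g +ᵥ y ∈ B} := measurable_const_vadd (-g) hB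
    rw [key, key]
    refine integral_mul_condMean (C := 1) hπ (integrable_of_bounded hf hC) ?_ fun x => ?_
    · have : Measurable[𝒴.comap π] ((π ⁻¹' {y | -g +ᵥ y ∈ B}).indicator (1 : X → ℂ)) :=
        (measurable_const (a := (1 : ℂ))).indicator ⟨_, hB', rfl⟩
      exact this.stronglyMeasurable.aestronglyMeasurable
    · by_cases h : -g +ᵥ π x ∈ B <;> simp [Set.indicator, h]
  · exact aestronglyMeasurable_comap_vadd g (hg g)
      (measurable_integral_condDistrib_id (π := π) (μ := μ) hf)

end CondMean

/-! ### The relative product -/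

section RelativeProduct

variable {X Y : Type*} [𝒳 : MeasurableSpace X] [StandardBorelSpace X] [Nonempty X]
  [𝒴 : MeasurableSpace Y] {μ : Measure X} [IsProbabilityMeasure μ] {π : X → Y}

theorem isProbabilityMeasure_relativeProduct (hπ : Measurable π) :
    IsProbabilityMeasure (relativeProduct μ π) := by
  have := Measure.isProbabilityMeasure_map (μ := μ) hπ.aemeasurable
  unfold relativeProduct
  infer_instance

theorem integral_relativeProduct_mul (hπ : Measurable π) {a b : X → ℂ} (ha : Measurable a)
    (hb : Measurable b)
    (hab : Integrable (fun p : X × X => a p.1 * b p.2) (relativeProduct μ π)) :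
    ∫ p, a p.1 * b p.2 ∂relativeProduct μ π = ∫ ω, condMean μ π a ω * condMean μ π b ω ∂μ := by
  have hk : relativeProduct μ π = ((condDistrib id π μ ×ₖ condDistrib id π μ) ∘ₖ
      Kernel.const Unit (μ.map π)) () := by
    rw [Kernel.comp_apply, Kernel.const_apply, relativeProduct]
  rw [hk] at hab ⊢
  rw [Kernel.integral_comp hab, Kernel.const_apply, integral_map hπ.aemeasurable]
  · refine integral_congr_ae (ae_of_all _ fun ω => ?_)
    simp only [Kernel.prod_apply]
    exact integral_prod_mul a b
  · simp only [Kernel.prod_apply, integral_prod_mul]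
    exact ((measurable_integral_condDistrib_id ha).mul
      (measurable_integral_condDistrib_id hb)).aestronglyMeasurable

variable {G : Type*} [AddGroup G] [AddAction G X] [MeasurableConstVAdd G X]
  [VAddInvariantMeasure G X μ] [AddAction G Y] [MeasurableConstVAdd G Y]

theorem measurePreserving_vadd_relativeProduct (hπ : Measurable π)
    (hg : ∀ g : G, ∀ᵐ x ∂μ, π (g +ᵥ x) = g +ᵥ π x) (g : G) :
    MeasurePreserving (fun p : X × X => (g +ᵥ p.1, g +ᵥ p.2)) (relativeProduct μ π)
      (relativeProduct μ π) := by
  have hm : Measurable fun p : X × X => (g +ᵥ p.1, g +ᵥ p.2) :=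
    (measurable_fst.const_vadd g).prodMk (measurable_snd.const_vadd g)
  have := isProbabilityMeasure_relativeProduct (μ := μ) hπ
  have := Measure.isProbabilityMeasure_map (μ := relativeProduct μ π) hm.aemeasurable
  refine ⟨hm, Measure.ext_prod fun {s t} hs ht => ?_⟩
  -- On a rectangle, the relative product is the integral of a product of conditional means.
  have key : ∀ {s t : Set X}, MeasurableSet s → MeasurableSet t →
      (((relativeProduct μ π).real (s ×ˢ t) : ℝ) : ℂ) =
        ∫ ω, condMean μ π (s.indicator 1) ω * condMean μ π (t.indicator 1) ω ∂μ := by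
    intro s t hs ht
    have h1 : (fun p : X × X => s.indicator (1 : X → ℂ) p.1 * t.indicator (1 : X → ℂ) p.2) =
        (s ×ˢ t).indicator 1 := by
      ext p
      by_cases h1 : p.1 ∈ s <;> by_cases h2 : p.2 ∈ t <;> simp [Set.indicator, h1, h2]
    have h2 : Integrable ((s ×ˢ t).indicator (1 : X × X → ℂ)) (relativeProduct μ π) :=
      (integrable_const (1 : ℂ)).indicator (hs.prod ht)
    rw [← integral_relativeProduct_mul hπ (measurable_one.indicator hs)
      (measurable_one.indicator ht) (h1 ▸ h2), h1]
    simp [integral_indicator (hs.prod ht), Measure.real]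
  have hb : ∀ (s : Set X) x, ‖s.indicator (1 : X → ℂ) x‖ ≤ 1 := fun s x => by
    by_cases h : x ∈ s <;> simp [Set.indicator, h]
  rw [Measure.map_apply hm (hs.prod ht)]
  have hpre : (fun p : X × X => (g +ᵥ p.1, g +ᵥ p.2)) ⁻¹' s ×ˢ t =
      ((g +ᵥ ·) ⁻¹' s) ×ˢ ((g +ᵥ ·) ⁻¹' t) := rfl
  rw [hpre, ← measureReal_eq_measureReal_iff]
  refine Complex.ofReal_injective ?_
  rw [key (measurable_const_vadd g hs) (measurable_const_vadd g ht), key hs ht,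
    ← integral_vadd_eq (μ := μ) g fun ω =>
      condMean μ π (s.indicator 1) ω * condMean μ π (t.indicator 1) ω]
  refine integral_congr_ae ?_
  filter_upwards [condMean_vadd hπ hg (measurable_one.indicator hs) (hb s) g,
    condMean_vadd hπ hg (measurable_one.indicator ht) (hb t) g] with ω h1 h2
  rw [h1, h2]
  rfl

end RelativeProduct

/-! ### Convex combinations of the vectors of an orbit -/

section Hilbert

variable {H : Type*} [NormedAddCommGroup H] [InnerProductSpace ℂ H]

open scoped InnerProductSpace

/-- The Alaoglu–Birkhoff form of the mean ergodic theorem: a vector orthogonal to the invariant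
vectors has convex combinations of its orbit of arbitrarily small norm, since the element of least
norm in the closed convex hull of the orbit is invariant. The subspace `S` may be any closed
subspace containing the orbit. -/
theorem exists_convex_combination_orbit_norm_lt [CompleteSpace H] {R : Type*} [AddMonoid R]
    (U : R → H →ₗᵢ[ℂ] H) (F : H) (hU : ∀ r s, U r (U s F) = U (r + s) F)
    (S : Submodule ℂ H) (hS : IsClosed (S : Set H)) (hFS : ∀ r, U r F ∈ S)
    (hF : ∀ v ∈ S, (∀ r, U r v = v) → ⟪v, F⟫_ℂ = 0) {ε : ℝ} (hε : 0 < ε) :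
    ∃ (ι : Type) (_ : Fintype ι) (w : ι → ℝ) (r : ι → R), (∀ i, 0 ≤ w i) ∧ ∑ i, w i = 1 ∧
      ‖∑ i, (w i : ℂ) • U (r i) F‖ < ε := by
  set O : Set H := Set.range fun r => U r F
  set K : Set H := closure (convexHull ℝ O)
  have hKconv : Convex ℝ K := (convex_convexHull ℝ O).closure
  have hOK : ∀ r, U r F ∈ K := fun r => subset_closure (subset_convexHull ℝ O ⟨r, rfl⟩)
  have hKS : K ⊆ S := by
    refine closure_minimal (convexHull_min ?_ ?_) hS
    · rintro _ ⟨r, rfl⟩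
      exact hFS r
    · exact (S.restrictScalars ℝ).convex
  have hUK : ∀ s, ∀ x ∈ K, U s x ∈ K := fun s x hx => by
    refine map_mem_closure (U s).continuous hx fun y hy => ?_
    have hconv : Convex ℝ ((U s).toLinearMap.restrictScalars ℝ ⁻¹' convexHull ℝ O) :=
      (convex_convexHull ℝ O).linear_preimage _
    refine convexHull_min ?_ hconv hy
    rintro _ ⟨r, rfl⟩
    refine subset_convexHull ℝ O ⟨s + r, ?_⟩
    exact (hU s r).symm
  let _ : InnerProductSpace ℝ H := InnerProductSpace.rclikeToReal ℂ H
  obtain ⟨v, hvK, hv⟩ := exists_norm_eq_iInf_of_complete_convex ⟨_, hOK 0⟩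
    isClosed_closure.isComplete hKconv 0
  -- The variational inequality at the point `v` of `K` closest to `0`.
  have hv' : ∀ w ∈ K, ‖v‖ ^ 2 ≤ (⟪v, w⟫_ℂ).re := fun w hw => by
    have h := (norm_eq_iInf_iff_real_inner_le_zero hKconv hvK).1 hv w hw
    rw [real_inner_eq_re_inner ℂ, zero_sub, inner_neg_left, inner_sub_right,
      inner_self_eq_norm_sq_to_K] at h
    have h2 : (⟪v, w⟫_ℂ - ((‖v‖ : ℝ) : ℂ) ^ 2).re = (⟪v, w⟫_ℂ).re - ‖v‖ ^ 2 := by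
      rw [← Complex.ofReal_pow, Complex.sub_re, Complex.ofReal_re]
    have h3 : (-(⟪v, w⟫_ℂ - ((‖v‖ : ℝ) : ℂ) ^ 2)).re ≤ 0 := h
    rw [Complex.neg_re, h2] at h3
    linarith
  have hinv : ∀ r, U r v = v := fun r => by
    have h1 := hv' _ (hUK r v hvK)
    have h2 : ‖v - U r v‖ ^ 2 = ‖v‖ ^ 2 - 2 * (⟪v, U r v⟫_ℂ).re + ‖U r v‖ ^ 2 :=
      norm_sub_sq (𝕜 := ℂ) v (U r v)
    rw [(U r).norm_map] at h2
    have h3 : ‖v - U r v‖ = 0 := by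
      have : ‖v - U r v‖ ^ 2 ≤ 0 := by linarith
      exact pow_eq_zero_iff two_ne_zero |>.1 (le_antisymm this (sq_nonneg _))
    exact (sub_eq_zero.1 (norm_eq_zero.1 h3)).symm
  have hv0 : v = 0 := by
    have h1 := hv' _ (hOK 0)
    have h2 : ⟪v, U 0 F⟫_ℂ = 0 := by
      rw [← hF v (hKS hvK) hinv, ← (U 0).inner_map_map v F, hinv]
    rw [h2, Complex.zero_re] at h1
    exact norm_eq_zero.1 (pow_eq_zero_iff two_ne_zero |>.1 (le_antisymm h1 (sq_nonneg _)))
  obtain ⟨y, hy, hyε⟩ := Metric.mem_closure_iff.1 (hv0 ▸ hvK) ε hε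
  rw [dist_zero_left] at hyε
  obtain ⟨κ, _, w, z, hw0, hw1, hz, hyz⟩ := mem_convexHull_iff_exists_fintype.1 hy
  choose r hr using hz
  let e := Fintype.equivFin κ
  refine ⟨Fin (Fintype.card κ), inferInstance, w ∘ e.symm, r ∘ e.symm, fun i => hw0 _, ?_, ?_⟩
  · rw [← hw1]
    exact e.symm.sum_comp w
  · have : ∑ i, (((w ∘ e.symm) i : ℝ) : ℂ) • U ((r ∘ e.symm) i) F = y := by
      rw [← hyz]
      refine (e.symm.sum_comp fun i => (w i : ℂ) • U (r i) F).trans ?_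
      refine Finset.sum_congr rfl fun i _ => ?_
      rw [← hr i]
      exact Complex.coe_smul (w i) _
    rwa [this]

theorem norm_sum_smul_sq_le {ι : Type*} [Fintype ι] (w : ι → ℝ) (hw : ∀ i, 0 ≤ w i) (e : ι → ℂ)
    (he : ∀ i, ‖e i‖ ≤ 1) (u : ι → H) :
    ‖∑ i, ((w i : ℂ) * e i) • u i‖ ^ 2 ≤ ∑ i, ∑ j, w i * w j * ‖⟪u i, u j⟫_ℂ‖ := by
  have h1 : ‖∑ i, ((w i : ℂ) * e i) • u i‖ ^ 2 =
      ‖⟪∑ i, ((w i : ℂ) * e i) • u i, ∑ i, ((w i : ℂ) * e i) • u i⟫_ℂ‖ := by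
    rw [inner_self_eq_norm_sq_to_K]
    simp
  rw [h1, sum_inner]
  refine (norm_sum_le _ _).trans (Finset.sum_le_sum fun i _ => ?_)
  rw [inner_sum]
  refine (norm_sum_le _ _).trans (Finset.sum_le_sum fun j _ => ?_)
  have h2 : ∀ i, ‖(w i : ℂ) * e i‖ ≤ w i := fun i => by
    rw [norm_mul, Complex.norm_real, Real.norm_of_nonneg (hw i)]
    exact mul_le_of_le_one_right (hw i) (he i)
  rw [inner_smul_left, inner_smul_right, norm_mul, norm_mul, RCLike.norm_conj, ← mul_assoc]
  exact mul_le_mul_of_nonneg_right (mul_le_mul (h2 i) (h2 j) (norm_nonneg _) (hw i))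
    (norm_nonneg _)

/-- A Bessel-type inequality: a vector correlates little, on average, with a family of vectors that
are nearly orthogonal on average. -/
theorem sum_norm_inner_sq_le {ι : Type*} [Fintype ι] (w : ι → ℝ) (hw : ∀ i, 0 ≤ w i)
    (φ : H) (u : ι → H) :
    (∑ i, w i * ‖⟪φ, u i⟫_ℂ‖) ^ 2 ≤ ‖φ‖ ^ 2 * ∑ i, ∑ j, w i * w j * ‖⟪u i, u j⟫_ℂ‖ := by
  choose e he1 he2 using fun i => RCLike.exists_norm_eq_mul_self ⟪φ, u i⟫_ℂ
  have h1 : ⟪φ, ∑ i, ((w i : ℂ) * e i) • u i⟫_ℂ = ((∑ i, w i * ‖⟪φ, u i⟫_ℂ‖ : ℝ) : ℂ) := by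
    rw [inner_sum, Complex.ofReal_sum]
    refine Finset.sum_congr rfl fun i _ => ?_
    rw [inner_smul_right, mul_assoc, ← he2 i, Complex.ofReal_mul]
    rfl
  have h0 : 0 ≤ ∑ i, w i * ‖⟪φ, u i⟫_ℂ‖ :=
    Finset.sum_nonneg fun i _ => mul_nonneg (hw i) (norm_nonneg _)
  have h2 : ∑ i, w i * ‖⟪φ, u i⟫_ℂ‖ ≤ ‖φ‖ * ‖∑ i, ((w i : ℂ) * e i) • u i‖ := by
    have := norm_inner_le_norm (𝕜 := ℂ) φ (∑ i, ((w i : ℂ) * e i) • u i)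
    rwa [h1, Complex.norm_real, Real.norm_of_nonneg h0] at this
  calc (∑ i, w i * ‖⟪φ, u i⟫_ℂ‖) ^ 2 ≤ (‖φ‖ * ‖∑ i, ((w i : ℂ) * e i) • u i‖) ^ 2 :=
        pow_le_pow_left₀ h0 h2 2
    _ ≤ _ := by
        rw [mul_pow]
        exact mul_le_mul_of_nonneg_left
          (norm_sum_smul_sq_le w hw e (fun i => (he1 i).le) u) (sq_nonneg _)

end Hilbert

/-! ### Asymptotically invariant averages and van der Corput's inequality -/

section VanDerCorput

/-- The averages with respect to the measures `P n` are asymptotically invariant under translation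
on bounded measurable functions. -/
def AsymptoticallyInvariant {R : Type*} [Add R] [MeasurableSpace R] (P : ℕ → Measure R) : Prop :=
  ∀ (a : R → ℝ) (C : ℝ), Measurable a → (∀ t, |a t| ≤ C) → ∀ r : R,
    Tendsto (fun n => ∫ t, a (t + r) ∂P n - ∫ t, a t ∂P n) atTop (𝓝 0)

theorem integrable_of_abs_le {R : Type*} [MeasurableSpace R] {P : Measure R} [IsFiniteMeasure P]
    {a : R → ℝ} {C : ℝ} (ha : Measurable a)
    (hC : ∀ t, |a t| ≤ C) : Integrable a P :=
  .of_bound ha.aestronglyMeasurable C (ae_of_all _ hC)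

variable {R : Type*} [AddCommGroup R] [MeasurableSpace R] [MeasurableAdd R]

open scoped InnerProductSpace

/-- Van der Corput's inequality: a bounded measurable family of vectors converges weakly to `0` on
average if its autocorrelations, averaged over finitely many weighted shifts, can be made small. -/
theorem tendsto_average_norm_inner {P : ℕ → Measure R} [∀ n, IsProbabilityMeasure (P n)]
    (hP : AsymptoticallyInvariant P) {H : Type*} [NormedAddCommGroup H] [InnerProductSpace ℂ H]
    {x : R → H} (hx : StronglyMeasurable x) {C : ℝ} (hC : ∀ t, ‖x t‖ ≤ C)
    (h : ∀ ε > 0, ∃ (ι : Type) (_ : Fintype ι) (w : ι → ℝ) (r : ι → R), (∀ i, 0 ≤ w i) ∧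
      ∑ i, w i = 1 ∧ ∀ᶠ n in atTop,
        ∫ t, ∑ i, ∑ j, w i * w j * ‖⟪x (t + r i), x (t + r j)⟫_ℂ‖ ∂P n ≤ ε) (φ : H) :
    Tendsto (fun n => ∫ t, ‖⟪φ, x t⟫_ℂ‖ ∂P n) atTop (𝓝 0) := by
  set a : R → ℝ := fun t => ‖⟪φ, x t⟫_ℂ‖ with ha
  have hxr : ∀ r, StronglyMeasurable fun t => x (t + r) := fun r =>
    hx.comp_measurable (measurable_add_const r)
  have ham : Measurable a := (stronglyMeasurable_const.inner hx).norm.measurable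
  have haC : ∀ t, |a t| ≤ ‖φ‖ * C := fun t => by
    rw [abs_of_nonneg (norm_nonneg _)]
    exact (norm_inner_le_norm _ _).trans (mul_le_mul_of_nonneg_left (hC t) (norm_nonneg _))
  refine Metric.tendsto_atTop'.2 fun ε hε => ?_
  set δ : ℝ := ε / 3 with hδ
  have hδ0 : 0 < δ := by positivity
  obtain ⟨ι, _, w, r, hw0, hw1, hB⟩ := h (δ * δ / (‖φ‖ ^ 2 + 1)) (by positivity)
  set S : R → ℝ := fun t => ∑ i, w i * a (t + r i) with hS
  set B : R → ℝ := fun t => ∑ i, ∑ j, w i * w j * ‖⟪x (t + r i), x (t + r j)⟫_ℂ‖ with hBdef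
  have hai : ∀ n r, Integrable (fun t => a (t + r)) (P n) := fun n r =>
    integrable_of_abs_le (ham.comp (measurable_add_const r)) fun t => haC _
  have hSint : ∀ n, ∫ t, S t ∂P n = ∑ i, w i * ∫ t, a (t + r i) ∂P n := fun n => by
    rw [integral_finsetSum _ fun i _ => (hai n _).const_mul _]
    exact Finset.sum_congr rfl fun i _ => integral_const_mul _ _
  have hSi : ∀ n, Integrable S (P n) := fun n =>
    integrable_finsetSum _ fun i _ => (hai n _).const_mul _
  have hBi : ∀ n, Integrable B (P n) := fun n => by
    refine integrable_finsetSum _ fun i _ => integrable_finsetSum _ fun j _ => ?_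
    refine Integrable.const_mul ?_ _
    refine integrable_of_abs_le (C := C * C) ((hxr _).inner (hxr _)).norm.measurable fun t => ?_
    rw [abs_of_nonneg (norm_nonneg _)]
    exact (norm_inner_le_norm _ _).trans
      (mul_le_mul (hC _) (hC _) (norm_nonneg _) ((norm_nonneg _).trans (hC t)))
  have hpt : ∀ t, S t ≤ δ + ‖φ‖ ^ 2 / δ * B t := fun t => by
    have h1 : S t ^ 2 ≤ ‖φ‖ ^ 2 * B t := sum_norm_inner_sq_le w hw0 φ fun i => x (t + r i)
    -- Splitting off `δ` replaces `S` by its square, which the Bessel inequality controls.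
    have h2 : S t ≤ δ + S t ^ 2 / δ := by
      rw [← sub_nonneg, show δ + S t ^ 2 / δ - S t = ((S t - δ / 2) ^ 2 + 3 / 4 * δ ^ 2) / δ by
        field_simp; ring]
      positivity
    have h3 : S t ^ 2 / δ ≤ ‖φ‖ ^ 2 / δ * B t := by
      rw [div_mul_eq_mul_div]
      exact div_le_div_of_nonneg_right h1 hδ0.le
    linarith
  have hdiff : Tendsto (fun n => ∫ t, S t ∂P n - ∫ t, a t ∂P n) atTop (𝓝 0) := by
    have h1 : Tendsto (fun n => ∑ i, w i * (∫ t, a (t + r i) ∂P n - ∫ t, a t ∂P n)) atTop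
        (𝓝 (∑ i, w i * 0)) :=
      tendsto_finsetSum _ fun i _ => (hP a _ ham haC (r i)).const_mul _
    simp only [mul_zero, Finset.sum_const_zero] at h1
    refine h1.congr fun n => ?_
    rw [hSint]
    simp only [mul_sub, Finset.sum_sub_distrib, ← Finset.sum_mul, hw1, one_mul]
  have hev := (Metric.tendsto_nhds.1 hdiff δ hδ0).and hB
  obtain ⟨N, hN⟩ := eventually_atTop.1 hev
  refine ⟨N, fun n hn => ?_⟩
  obtain ⟨h1, h2⟩ := hN n hn.le
  have h3 : ∫ t, S t ∂P n ≤ δ + ‖φ‖ ^ 2 / δ * ∫ t, B t ∂P n := by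
    have := integral_mono (hSi n) ((integrable_const δ).add ((hBi n).const_mul _)) hpt
    rw [integral_add' (integrable_const δ) ((hBi n).const_mul _), integral_const_mul] at this
    simpa using this
  have h4 : ‖φ‖ ^ 2 / δ * ∫ t, B t ∂P n ≤ δ := by
    calc ‖φ‖ ^ 2 / δ * ∫ t, B t ∂P n ≤ ‖φ‖ ^ 2 / δ * (δ * δ / (‖φ‖ ^ 2 + 1)) :=
          mul_le_mul_of_nonneg_left h2 (by positivity)
      _ = δ * (‖φ‖ ^ 2 / (‖φ‖ ^ 2 + 1)) := by field_simp
      _ ≤ δ := mul_le_of_le_one_right hδ0.le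
          (div_le_one_of_le₀ (by linarith) (by positivity))
  have h5 : 0 ≤ ∫ t, a t ∂P n := integral_nonneg fun t => norm_nonneg _
  rw [Real.dist_eq, sub_zero] at h1 ⊢
  rw [abs_of_nonneg h5]
  have := neg_abs_le (∫ t, S t ∂P n - ∫ t, a t ∂P n)
  have hε3 : ε = 3 * δ := by rw [hδ]; ring
  linarith

end VanDerCorput

/-! ### Averages over a weak Følner sequence -/

section Folner

theorem IsWeakFolner.isProbabilityMeasure_cond {R : Type*} [AddCommGroup R]
    [TopologicalSpace R] [MeasurableSpace R] {lam : Measure R} [lam.IsAddHaarMeasure]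
    {F : ℕ → Set R} (hF : IsWeakFolner lam F) (n : ℕ) :
    IsProbabilityMeasure lam[|F n] :=
  cond_isProbabilityMeasure_of_finite (hF.measure_pos n).ne' (hF.isCompact n).measure_lt_top.ne

variable {R : Type*} [AddCommGroup R] [TopologicalSpace R] [T2Space R] [MeasurableSpace R]
  [BorelSpace R]
  {lam : Measure R} [lam.IsAddHaarMeasure] {F : ℕ → Set R}

theorem IsWeakFolner.asymptoticallyInvariant_cond [IsTopologicalAddGroup R]
    (hF : IsWeakFolner lam F) :
    AsymptoticallyInvariant fun n => lam[|F n] := by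
  intro a C ha hC r
  have hC0 : 0 ≤ C := (abs_nonneg _).trans (hC 0)
  have hmeas : ∀ n, MeasurableSet (F n) := fun n => (hF.isCompact n).measurableSet
  set F' : ℕ → Set R := fun n => (fun t => r + t) '' F n with hF'
  have hcF' : ∀ n, IsCompact (F' n) := fun n => (hF.isCompact n).image (continuous_const_add r)
  have hF'm : ∀ n, MeasurableSet (F' n) := fun n => (hcF' n).measurableSet
  have hfin : ∀ n, lam (symmDiff (F' n) (F n)) < ⊤ := fun n =>
    (measure_mono Set.symmDiff_subset_union).trans_lt
      (((hcF' n).union (hF.isCompact n)).measure_lt_top)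
  have hshift : ∀ n, ∫ t in F n, a (t + r) ∂lam = ∫ t in F' n, a t ∂lam := fun n => by
    rw [hF', MeasurePreserving.setIntegral_image_emb (measurePreserving_add_left lam r)
      (measurableEmbedding_addLeft r)]
    simp only [add_comm]
  have hint : ∀ {s : Set R}, lam s < ⊤ → IntegrableOn a s lam := fun hs =>
    Measure.integrableOn_of_bounded hs.ne ha.aestronglyMeasurable (ae_of_all _ hC)
  have hbound : ∀ n, |∫ t in F' n, a t ∂lam - ∫ t in F n, a t ∂lam| ≤
      C * lam.real (symmDiff (F' n) (F n)) := fun n => by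
    have h1 := integral_inter_add_sdiff (μ := lam) (s := F' n) (t := F n) (hmeas n)
      (hint (hcF' n).measure_lt_top)
    have h2 := integral_inter_add_sdiff (μ := lam) (s := F n) (t := F' n) (hF'm n)
      (hint (hF.isCompact n).measure_lt_top)
    have d1 : lam (F' n \ F n) < ⊤ :=
      (measure_mono Set.sdiff_subset).trans_lt (hcF' n).measure_lt_top
    have d2 : lam (F n \ F' n) < ⊤ :=
      (measure_mono Set.sdiff_subset).trans_lt (hF.isCompact n).measure_lt_top
    have h3 := norm_setIntegral_le_of_norm_le_const (μ := lam) (f := a) d1 fun t _ => hC t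
    have h4 := norm_setIntegral_le_of_norm_le_const (μ := lam) (f := a) d2 fun t _ => hC t
    have h5 : lam.real (symmDiff (F' n) (F n)) =
        lam.real (F' n \ F n) + lam.real (F n \ F' n) := by
      rw [Set.symmDiff_def, measureReal_union disjoint_sdiff_sdiff ((hmeas n).diff (hF'm n))
        d1.ne d2.ne]
    rw [Set.inter_comm] at h2
    rw [← h1, ← h2, add_sub_add_left_eq_sub, h5, mul_add]
    exact (norm_sub_le _ _).trans (add_le_add h3 h4)
  have hlim : Tendsto (fun n => C * (lam (symmDiff (F' n) (F n)) / lam (F n)).toReal) atTop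
      (𝓝 0) := by
    have := ((ENNReal.tendsto_toReal ENNReal.zero_ne_top).comp (hF.tendsto_symmDiff r)).const_mul C
    rwa [ENNReal.toReal_zero, mul_zero] at this
  refine squeeze_zero_norm (fun n => ?_) hlim
  have hc : ∀ b : R → ℝ, ∫ t, b t ∂lam[|F n] = (lam.real (F n))⁻¹ * ∫ t in F n, b t ∂lam :=
    fun b => by
      rw [ProbabilityTheory.cond, integral_smul_measure, ENNReal.toReal_inv, smul_eq_mul]
      rfl
  rw [hc, hc, hshift, ← mul_sub, norm_mul, norm_inv, Real.norm_of_nonneg measureReal_nonneg,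
    ENNReal.toReal_div, ← mul_div_assoc, inv_mul_eq_div]
  exact div_le_div_of_nonneg_right (hbound n) ENNReal.toReal_nonneg

/-- Chebyshev's inequality for densities: a bounded function whose averages tend to `0` is small
off a set of density `0`. -/
theorem IsWeakFolner.tendsto_measure_of_tendsto_average (hF : IsWeakFolner lam F) {a : R → ℝ}
    {C : ℝ} (ha : Measurable a) (ha0 : ∀ t, 0 ≤ a t) (hC : ∀ t, a t ≤ C)
    (h : Tendsto (fun n => ∫ t, a t ∂lam[|F n]) atTop (𝓝 0)) {ε : ℝ} (hε : 0 < ε) :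
    Tendsto (fun n => lam ({t | ε ≤ a t} ∩ F n) / lam (F n)) atTop (𝓝 0) := by
  have := hF.isProbabilityMeasure_cond
  have hcond : ∀ n, lam ({t | ε ≤ a t} ∩ F n) / lam (F n) =
      ENNReal.ofReal ((lam[|F n]).real {t | ε ≤ a t}) := fun n => by
    rw [ofReal_measureReal, cond_apply (hF.isCompact n).measurableSet, Set.inter_comm,
      mul_comm, div_eq_mul_inv]
  simp_rw [hcond]
  rw [← ENNReal.ofReal_zero]
  refine ENNReal.tendsto_ofReal ?_
  refine squeeze_zero (fun n => measureReal_nonneg) (fun n => ?_)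
    (by simpa using h.const_mul ε⁻¹)
  have hai : Integrable a lam[|F n] :=
    .of_bound ha.aestronglyMeasurable C (ae_of_all _ fun t => by
      rw [Real.norm_of_nonneg (ha0 t)]; exact hC t)
  rw [inv_mul_eq_div, le_div_iff₀' hε]
  exact mul_meas_ge_le_integral_of_nonneg (ae_of_all _ ha0) hai ε

end Folner

/-! ### Functions with values in `L²` -/

section LTwo

open scoped InnerProductSpace ComplexConjugate

variable {X : Type*} [MeasurableSpace X] {μ : Measure X}

theorem inner_toLp_eq_integral {a b : X → ℂ} (ha : MemLp a 2 μ) (hb : MemLp b 2 μ) :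
    ⟪ha.toLp a, hb.toLp b⟫_ℂ = ∫ ω, conj (a ω) * b ω ∂μ := by
  rw [L2.inner_def]
  refine integral_congr_ae ?_
  filter_upwards [ha.coeFn_toLp, hb.coeFn_toLp] with ω h1 h2
  rw [h1, h2, RCLike.inner_apply, mul_comm]

theorem measurable_of_measurable_edist {R E : Type*} [MeasurableSpace R] [PseudoEMetricSpace E]
    [SecondCountableTopology E] [MeasurableSpace E] [BorelSpace E] {x : R → E}
    (h : ∀ c, Measurable fun t => edist (x t) c) : Measurable x := by
  refine measurable_of_isOpen fun U hU => ?_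
  choose! ε hε hεU using fun c (hc : c ∈ U) => EMetric.isOpen_iff.1 hU c hc
  obtain ⟨T, hT, hTU⟩ := TopologicalSpace.isOpen_iUnion_countable
    (fun c : U => Metric.eball (c : E) (ε c)) fun c => Metric.isOpen_eball
  have hU' : U = ⋃ c ∈ T, Metric.eball (c : E) (ε c) := by
    rw [hTU]
    refine subset_antisymm (fun c hc => ?_) (Set.iUnion_subset fun c => hεU c c.2)
    exact Set.mem_iUnion.2 ⟨⟨c, hc⟩, Metric.mem_eball_self (hε c hc)⟩
  rw [hU', Set.preimage_iUnion₂]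
  exact MeasurableSet.biUnion hT fun c _ => measurableSet_lt (h c) measurable_const

/-- A jointly measurable function on a product defines a measurable map into `L²`. -/
theorem stronglyMeasurable_toLp [IsFiniteMeasure μ] [MeasurableSpace.CountablyGenerated X]
    {R : Type*} [MeasurableSpace R] {u : R → X → ℂ} (hu : Measurable (Function.uncurry u))
    (h2 : ∀ t, MemLp (u t) 2 μ) : StronglyMeasurable fun t => (h2 t).toLp (u t) := by
  have : Fact ((2 : ENNReal) ≠ ⊤) := ⟨ENNReal.ofNat_ne_top⟩
  let _ : MeasurableSpace (Lp ℂ 2 μ) := borel _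
  have : BorelSpace (Lp ℂ 2 μ) := ⟨rfl⟩
  refine Measurable.stronglyMeasurable (measurable_of_measurable_edist fun c => ?_)
  have h3 : ∀ t, edist ((h2 t).toLp (u t)) c =
      (∫⁻ ω, ‖u t ω - c ω‖ₑ ^ (2 : ℝ) ∂μ) ^ (1 / (2 : ℝ)) := fun t => by
    rw [Lp.edist_def, eLpNorm_congr_ae ((h2 t).coeFn_toLp.sub (ae_eq_refl c)),
      eLpNorm_eq_lintegral_rpow_enorm_toReal two_ne_zero ENNReal.ofNat_ne_top]
    simp
  simp_rw [h3]
  have hc : Measurable c := (Lp.stronglyMeasurable c).measurable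
  refine Measurable.pow_const (Measurable.lintegral_prod_right' (f := fun p : R × X =>
    ‖u p.1 p.2 - c p.2‖ₑ ^ (2 : ℝ)) ?_) _
  exact ((hu.sub (hc.comp measurable_snd)).enorm).pow_const _

end LTwo

/-! ### Correlations over the fibres of a relatively weak-mixing extension -/

section TranslateCorrelation

open scoped ComplexConjugate

variable {G X : Type*} [VAdd G X]

/-- The product `conj (g f) * (h f)` of two translates of `f`. -/
def translateCorrelation (f : X → ℂ) (g h : G) (ω : X) : ℂ :=
  conj (f (g +ᵥ ω)) * f (h +ᵥ ω)

theorem norm_translateCorrelation_le {f : X → ℂ} {C : ℝ} (hC : ∀ x, ‖f x‖ ≤ C) (g h : G) (ω : X) :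
    ‖translateCorrelation f g h ω‖ ≤ C * C := by
  rw [translateCorrelation, norm_mul, RCLike.norm_conj]
  exact mul_le_mul (hC _) (hC _) (norm_nonneg _) ((norm_nonneg _).trans (hC ω))

theorem measurable_translateCorrelation [MeasurableSpace X] {f : X → ℂ} (hf : Measurable f)
    (hinv : ∀ g : G, Measurable fun x : X => g +ᵥ x) (g h : G) :
    Measurable (translateCorrelation f g h) :=
  (RCLike.continuous_conj.measurable.comp (hf.comp (hinv g))).mul (hf.comp (hinv h))

end TranslateCorrelation

section WeakMixing

open scoped InnerProductSpace ComplexConjugate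

variable {R G X Y : Type*} [Ring R] [AddCommGroup G] [Module R G]
  (𝒳' : MeasurableSpace X) [𝒳 : MeasurableSpace X] [StandardBorelSpace X] [Nonempty X]
  [AddAction G X] [MeasurableConstVAdd G X] {μ : Measure X} [IsProbabilityMeasure μ]
  [VAddInvariantMeasure G X μ] [MeasurableSpace Y] [AddAction G Y] [MeasurableConstVAdd G Y]
  {π : X → Y}

theorem condMean_conj (f : X → ℂ) (ω : X) :
    condMean μ π (fun x => conj (f x)) ω = conj (condMean μ π f ω) :=
  integral_conj

/-- If `f` has mean zero on the fibres of a relatively weak-mixing extension, then `f` is nearly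
orthogonal on the fibres to its translates, on average over suitable convex combinations: in the
relative product, `f ⊗ conj f` is orthogonal to the invariant functions, and the fibrewise
correlations of `f` are those of `f ⊗ conj f` in the relative product. -/
theorem IsRelativelyWeakMixingFor.exists_weights {ν : Measure Y} (hπ : IsFactorMap G 𝒳' μ ν π)
    {g : G} (hwm : IsRelativelyWeakMixingFor R 𝒳' μ π g) {f : X → ℂ} (hf : Measurable[𝒳'] f)
    {C : ℝ} (hC : ∀ x, ‖f x‖ ≤ C) (hf0 : condMean μ π f =ᵐ[μ] 0) {ε : ℝ} (hε : 0 < ε) :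
    ∃ (ι : Type) (_ : Fintype ι) (w : ι → ℝ) (r : ι → R), (∀ i, 0 ≤ w i) ∧ ∑ i, w i = 1 ∧
      ∑ i, ∑ j, w i * w j * ∫ ω, ‖condMean μ π
        (translateCorrelation f (r i • g) (r j • g)) ω‖ ^ 2 ∂μ ≤ ε := by
  have hπm : Measurable π := hπ.measurable.mono hπ.le le_rfl
  have hfm : Measurable f := hf.mono hπ.le le_rfl
  have hprob := isProbabilityMeasure_relativeProduct (μ := μ) hπm
  set ρ := relativeProduct μ π with hρ
  have hD := measurePreserving_vadd_relativeProduct (μ := μ) hπm hπ.equivariant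
  set D : G → X × X → X × X := fun h p => (h +ᵥ p.1, h +ᵥ p.2) with hDdef
  set Φ : X × X → ℂ := fun p => f p.1 * conj (f p.2) with hΦ
  have hconj : Measurable fun x => conj (f x) := RCLike.continuous_conj.measurable.comp hfm
  have hΦm : Measurable Φ := (hfm.comp measurable_fst).mul (hconj.comp measurable_snd)
  have hΦC : ∀ p, ‖Φ p‖ ≤ C * C := fun p => by
    rw [hΦ, norm_mul, RCLike.norm_conj]
    exact mul_le_mul (hC _) (hC _) (norm_nonneg _) ((norm_nonneg _).trans (hC p.1))
  have hΦD : ∀ h, MemLp (Φ ∘ D h) 2 ρ := fun h =>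
    MemLp.of_bound (hΦm.comp (hD h).measurable).aestronglyMeasurable (C * C)
      (ae_of_all _ fun p => hΦC _)
  have hΦ2 : MemLp Φ 2 ρ := MemLp.of_bound hΦm.aestronglyMeasurable (C * C) (ae_of_all _ hΦC)
  let U : R → Lp ℂ 2 ρ →ₗᵢ[ℂ] Lp ℂ 2 ρ := fun r =>
    Lp.compMeasurePreservingₗᵢ ℂ (D (r • g)) (hD (r • g))
  have hUΦ : ∀ r, U r (hΦ2.toLp Φ) = (hΦD (r • g)).toLp (Φ ∘ D (r • g)) := fun r =>
    Lp.toLp_compMeasurePreserving hΦ2 (hD (r • g))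
  have hU : ∀ r s, U r (U s (hΦ2.toLp Φ)) = U (r + s) (hΦ2.toLp Φ) := fun r s => by
    rw [hUΦ, hUΦ]
    refine (Lp.toLp_compMeasurePreserving (hΦD (s • g)) (hD (r • g))).trans ?_
    congr 1
    funext p
    simp only [hDdef, Function.comp_apply, vadd_vadd, add_smul, add_comm (s • g)]
  have hle : 𝒳'.prod 𝒳' ≤ 𝒳.prod 𝒳 :=
    sup_le_sup (MeasurableSpace.comap_mono hπ.le) (MeasurableSpace.comap_mono hπ.le)
  have hΦ' : ∀ r : R, Measurable[𝒳'.prod 𝒳'] (Φ ∘ D (r • g)) := fun r => by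
    have h1 : Measurable[𝒳'] fun x => f ((r • g) +ᵥ x) := hf.comp (hπ.invariant _)
    have h2 : Measurable[𝒳'] fun x => conj (f ((r • g) +ᵥ x)) :=
      RCLike.continuous_conj.measurable.comp h1
    exact Measurable.mul (h1.comp (@measurable_fst X X 𝒳' 𝒳'))
      (h2.comp (@measurable_snd X X 𝒳' 𝒳'))
  obtain ⟨ι, _, w, r, hw0, hw1, hlt⟩ := exists_convex_combination_orbit_norm_lt U (hΦ2.toLp Φ) hU
    (lpMeas ℂ ℂ (𝒳'.prod 𝒳') 2 ρ) (isClosed_aestronglyMeasurable hle) (fun r => by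
      rw [mem_lpMeas_iff_aestronglyMeasurable, hUΦ]
      exact ((hΦ' r).stronglyMeasurable.aestronglyMeasurable).congr (hΦD _).coeFn_toLp.symm)
    (fun v hv hinv => by
      -- An invariant `v` is a function of `π x₁`, so integrating `conj v * Φ` in `x₂` first gives
      -- the factor `conj (E f) = 0`.
      obtain ⟨k, hk, hvk⟩ := hwm v (Lp.memLp v) (mem_lpMeas_iff_aestronglyMeasurable.1 hv)
        (fun h hh => by
          obtain ⟨s, rfl⟩ := Submodule.mem_span_singleton.1 hh
          have h1 := Lp.coeFn_compMeasurePreserving v (hD (s • g))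
          have h2 : Lp.compMeasurePreserving _ (hD (s • g)) v = v := hinv s
          rw [h2] at h1
          exact h1.symm)
      have h1 : (fun p => ⟪v p, hΦ2.toLp Φ p⟫_ℂ) =ᵐ[ρ]
          fun p => (conj (k (π p.1)) * f p.1) * conj (f p.2) := by
        filter_upwards [hvk, hΦ2.coeFn_toLp] with p h1 h2
        rw [h1, h2, RCLike.inner_apply, hΦ]
        ring
      have h2 := (L2.integrable_inner (𝕜 := ℂ) v (hΦ2.toLp Φ)).congr h1
      rw [L2.inner_def, integral_congr_ae h1, integral_relativeProduct_mul hπm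
        (a := fun x => conj (k (π x)) * f x)
        ((RCLike.continuous_conj.measurable.comp (hk.comp hπm)).mul hfm) hconj h2]
      refine integral_eq_zero_of_ae ?_
      filter_upwards [hf0] with ω hω
      rw [condMean_conj, hω]
      simp)
    (Real.sqrt_pos.2 hε)
  refine ⟨ι, inferInstance, w, r, hw0, hw1, ?_⟩
  have hinner : ∀ i j, ⟪U (r i) (hΦ2.toLp Φ), U (r j) (hΦ2.toLp Φ)⟫_ℂ =
      ((∫ ω, ‖condMean μ π
        (translateCorrelation f (r i • g) (r j • g)) ω‖ ^ 2 ∂μ : ℝ) : ℂ) := by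
    intro i j
    set a : X → ℂ := translateCorrelation f (r i • g) (r j • g) with ha
    have ham : Measurable a := measurable_translateCorrelation hfm measurable_const_vadd _ _
    have haC : ∀ x, ‖a x‖ ≤ C * C := norm_translateCorrelation_le hC _ _
    have hacm : Measurable fun x => conj (a x) := RCLike.continuous_conj.measurable.comp ham
    have hC0 : 0 ≤ C * C := mul_self_nonneg C
    rw [hUΦ, hUΦ, inner_toLp_eq_integral]
    have h1 : ∀ p, conj ((Φ ∘ D (r i • g)) p) * (Φ ∘ D (r j • g)) p = a p.1 * conj (a p.2) := by
      intro p
      simp only [hΦ, hDdef, ha, translateCorrelation, Function.comp_apply, map_mul,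
        Complex.conj_conj]
      ring
    simp_rw [h1]
    rw [integral_relativeProduct_mul hπm ham hacm, ← integral_complex_ofReal]
    · refine integral_congr_ae (ae_of_all _ fun ω => ?_)
      simp only [condMean_conj]
      rw [Complex.mul_conj, Complex.normSq_eq_norm_sq]
    · refine Integrable.of_bound ((ham.comp measurable_fst).mul
        (hacm.comp measurable_snd)).aestronglyMeasurable (C * C * (C * C)) (ae_of_all _ fun p => ?_)
      rw [norm_mul, RCLike.norm_conj]
      exact mul_le_mul (haC _) (haC _) (norm_nonneg _) hC0
  have hsq : ((∑ i, ∑ j, w i * w j * ∫ ω, ‖condMean μ π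
        (translateCorrelation f (r i • g) (r j • g)) ω‖ ^ 2 ∂μ : ℝ) : ℂ) =
      ((‖∑ i, (w i : ℂ) • U (r i) (hΦ2.toLp Φ)‖ ^ 2 : ℝ) : ℂ) := by
    have h1 := inner_self_eq_norm_sq_to_K (𝕜 := ℂ) (∑ i, (w i : ℂ) • U (r i) (hΦ2.toLp Φ))
    rw [Complex.ofReal_pow]
    refine Eq.trans ?_ h1
    rw [sum_inner, Complex.ofReal_sum]
    refine Finset.sum_congr rfl fun i _ => ?_
    rw [inner_sum, Complex.ofReal_sum]
    refine Finset.sum_congr rfl fun j _ => ?_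
    rw [inner_smul_left, inner_smul_right, hinner, Complex.conj_ofReal]
    push_cast
    ring
  rw [Complex.ofReal_injective hsq]
  have := pow_le_pow_left₀ (norm_nonneg _) hlt.le 2
  rwa [Real.sq_sqrt hε.le] at this

end WeakMixing

/-! ### Products of translates -/

section TranslateProd

variable {R G X : Type*} [Ring R] [AddCommGroup G] [Module R G] [AddAction G X] {l : ℕ}

/-- The product `∏ Tᵢᵗ fᵢ` of the translates of the functions `fᵢ` by the elements `t • Tᵢ`. -/
def translateProd (T : Fin l → G) (f : Fin l → X → ℂ) (t : R) (ω : X) : ℂ :=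
  ∏ i, f i ((t • T i) +ᵥ ω)

theorem norm_translateProd_le (T : Fin l → G) {f : Fin l → X → ℂ} {C : ℝ}
    (hC : ∀ i x, ‖f i x‖ ≤ C) (t : R) (ω : X) : ‖translateProd T f t ω‖ ≤ C ^ l := by
  unfold translateProd
  rw [norm_prod]
  refine (Finset.prod_le_prod (fun i _ => norm_nonneg _) fun i _ => hC i _).trans ?_
  simp

theorem measurable_translateProd [MeasurableSpace X] (T : Fin l → G) {f : Fin l → X → ℂ}
    (hf : ∀ i, Measurable (f i)) (hinv : ∀ g : G, Measurable fun x : X => g +ᵥ x) (t : R) :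
    Measurable (translateProd T f t) := by
  unfold translateProd
  exact Finset.measurable_prod _ fun i _ => (hf i).comp (hinv _)

theorem measurable_uncurry_translateProd [TopologicalSpace R] [MeasurableSpace R] [BorelSpace R]
    [TopologicalSpace G] [MeasurableSpace G] [BorelSpace G] [ContinuousSMul R G]
    [MeasurableSpace X] [MeasurableVAdd₂ G X] (T : Fin l → G) {f : Fin l → X → ℂ}
    (hf : ∀ i, Measurable (f i)) :
    Measurable (Function.uncurry (translateProd (R := R) T f)) := by
  have h : ∀ i, Measurable fun p : R × X => f i ((p.1 • T i) +ᵥ p.2) := fun i => by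
    have h1 : Continuous fun t : R => t • T i := continuous_id.smul continuous_const
    exact (hf i).comp ((h1.measurable.comp measurable_fst).vadd measurable_snd)
  change Measurable fun p : R × X => ∏ i, f i ((p.1 • T i) +ᵥ p.2)
  exact Finset.measurable_prod _ fun i _ => h i

theorem translateProd_sub_update (T : Fin l → G) (f : Fin l → X → ℂ) (j : Fin l) (a : X → ℂ)
    (t : R) (ω : X) :
    translateProd T f t ω - translateProd T (Function.update f j a) t ω =
      translateProd T (Function.update f j (fun x => f j x - a x)) t ω := by
  unfold translateProd
  rw [← Finset.mul_prod_erase _ _ (Finset.mem_univ j),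
    ← Finset.mul_prod_erase (a := j) (f := fun i => Function.update f j a i _) _
      (Finset.mem_univ j),
    ← Finset.mul_prod_erase (a := j) (f := fun i => Function.update f j (fun x => f j x - a x) i _)
      _ (Finset.mem_univ j)]
  have h : ∀ b : X → ℂ, ∏ i ∈ Finset.univ.erase j, Function.update f j b i ((t • T i) +ᵥ ω) =
      ∏ i ∈ Finset.univ.erase j, f i ((t • T i) +ᵥ ω) := fun b =>
    Finset.prod_congr rfl fun i hi => by rw [Function.update_of_ne (Finset.ne_of_mem_erase hi)]
  rw [h, h, Function.update_self, Function.update_self, sub_mul]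

open scoped ComplexConjugate in
/-- Moving by `-(t • T j)` turns the autocorrelation of a product of translates into the integral
of a product with one factor fixed and the others translated by `t • (T i - T j)`. -/
theorem integral_conj_translateProd_mul [MeasurableSpace X] [MeasurableConstVAdd G X]
    {μ : Measure X} [VAddInvariantMeasure G X μ] {T : Fin (l + 1) → G}
    (f : Fin (l + 1) → X → ℂ) (j : Fin (l + 1)) (s r t : R) :
    ∫ ω, conj (translateProd T f (t + s) ω) * translateProd T f (t + r) ω ∂μ =
      ∫ ω, translateCorrelation (f j) (s • T j) (r • T j) ω *
        translateProd (fun k => T (j.succAbove k) - T j) (fun k => translateCorrelation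
          (f (j.succAbove k)) (s • T (j.succAbove k)) (r • T (j.succAbove k))) t ω ∂μ := by
  rw [← integral_vadd_eq (μ := μ) (-(t • T j))]
  refine integral_congr_ae (ae_of_all _ fun ω => ?_)
  simp only [translateProd, translateCorrelation]
  rw [map_prod, ← Finset.prod_mul_distrib, Fin.prod_univ_succAbove _ j]
  congr 1
  · simp only [vadd_vadd, add_smul]
    congr 3 <;> abel_nf
  · refine Finset.prod_congr rfl fun k _ => ?_
    simp only [vadd_vadd, add_smul, smul_sub]
    congr 3 <;> abel_nf

/-- The averages with respect to `P n` of the correlations of a function `φ` in `L²` with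
`∏ Tᵢᵗ fᵢ - ∏ Tᵢᵗ E(fᵢ | Y)` tend to `0`, for every product of `l` translates of bounded functions
by distinct non-zero elements. -/
def HasRelativelyIndependentTranslates [MeasurableSpace R] {Y : Type*}
    (𝒳' : MeasurableSpace X) [MeasurableSpace X] [StandardBorelSpace X] [Nonempty X]
    (μ : Measure X) [IsProbabilityMeasure μ] [MeasurableSpace Y] (π : X → Y)
    (P : ℕ → Measure R) (l : ℕ) : Prop :=
  ∀ T : Fin l → G, Function.Injective T → (∀ i, T i ≠ 0) → ∀ (f : Fin l → X → ℂ) (C : ℝ),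
    (∀ i, Measurable[𝒳'] (f i)) → (∀ i x, ‖f i x‖ ≤ C) → ∀ φ : X → ℂ, Measurable φ → MemLp φ 2 μ →
    Tendsto (fun n => ∫ t, ‖∫ ω, φ ω * (translateProd T f t ω -
      translateProd T (fun i => condMean μ π (f i)) t ω) ∂μ‖ ∂P n) atTop (𝓝 0)

end TranslateProd

section Pairing

variable {R X : Type*} [MeasurableSpace R] [MeasurableSpace X] {μ : Measure X}

theorem norm_integral_mul_le {φ u : X → ℂ} (hφ : Integrable φ μ) {D : ℝ} (hD : ∀ ω, ‖u ω‖ ≤ D) :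
    ‖∫ ω, φ ω * u ω ∂μ‖ ≤ D * ∫ ω, ‖φ ω‖ ∂μ := by
  rw [← integral_const_mul]
  refine norm_integral_le_of_norm_le (hφ.norm.const_mul D) (ae_of_all _ fun ω => ?_)
  rw [norm_mul, mul_comm]
  exact mul_le_mul_of_nonneg_right (hD ω) (norm_nonneg _)

theorem measurable_integral_mul [SFinite μ] {φ : X → ℂ} (hφ : Measurable φ) {u : R → X → ℂ}
    (hu : Measurable (Function.uncurry u)) : Measurable fun t => ∫ ω, φ ω * u t ω ∂μ :=
  (StronglyMeasurable.integral_prod_right' (f := fun p : R × X => φ p.2 * u p.1 p.2)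
    ((hφ.comp measurable_snd).mul hu).stronglyMeasurable).measurable

theorem integrable_norm_integral_mul [SFinite μ] {P : Measure R} [IsFiniteMeasure P]
    {φ : X → ℂ} (hφ : Measurable φ) (hφi : Integrable φ μ) {u : R → X → ℂ}
    (hu : Measurable (Function.uncurry u)) {D : ℝ} (hD : ∀ t ω, ‖u t ω‖ ≤ D) :
    Integrable (fun t => ‖∫ ω, φ ω * u t ω ∂μ‖) P :=
  integrable_of_abs_le (measurable_integral_mul hφ hu).norm fun t => by
    rw [abs_norm]
    exact norm_integral_mul_le hφi (hD t)

theorem eventually_average_sum_le {P : ℕ → Measure R} [∀ n, IsProbabilityMeasure (P n)]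
    {ι : Type*} [Fintype ι] {w : ι → ℝ} (hw0 : ∀ i, 0 ≤ w i) {k e : ι → ι → R → ℝ} {γ : ι → ι → ℝ}
    (hk0 : ∀ a b t, 0 ≤ k a b t) (hke : ∀ a b t, k a b t ≤ e a b t + γ a b)
    (hei : ∀ n a b, Integrable (e a b) (P n))
    (helim : ∀ a b, Tendsto (fun n => ∫ t, e a b t ∂P n) atTop (𝓝 0)) {ε : ℝ}
    (hγ : ∑ a, ∑ b, w a * w b * γ a b < ε) :
    ∀ᶠ n in atTop, ∫ t, ∑ a, ∑ b, w a * w b * k a b t ∂P n ≤ ε := by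
  have hlim : Tendsto (fun n => ∑ a, ∑ b, w a * w b * (∫ t, e a b t ∂P n + γ a b)) atTop
      (𝓝 (∑ a, ∑ b, w a * w b * (0 + γ a b))) :=
    tendsto_finsetSum _ fun a _ => tendsto_finsetSum _ fun b _ =>
      ((helim a b).add_const _).const_mul _
  simp only [zero_add] at hlim
  filter_upwards [hlim.eventually (gt_mem_nhds hγ)] with n hn
  have hri : ∀ a b, Integrable (fun t => w a * w b * (e a b t + γ a b)) (P n) :=
    fun a b => ((hei n a b).add (integrable_const _)).const_mul _
  calc ∫ t, ∑ a, ∑ b, w a * w b * k a b t ∂P n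
      ≤ ∫ t, ∑ a, ∑ b, w a * w b * (e a b t + γ a b) ∂P n := by
        refine integral_mono_of_nonneg (ae_of_all _ fun t => ?_)
          (integrable_finsetSum _ fun a _ => integrable_finsetSum _ fun b _ => hri a b)
          (ae_of_all _ fun t => ?_)
        · exact Finset.sum_nonneg fun a _ => Finset.sum_nonneg fun b _ =>
            mul_nonneg (mul_nonneg (hw0 a) (hw0 b)) (hk0 a b t)
        · exact Finset.sum_le_sum fun a _ => Finset.sum_le_sum fun b _ =>
            mul_le_mul_of_nonneg_left (hke a b t) (mul_nonneg (hw0 a) (hw0 b))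
    _ = ∑ a, ∑ b, w a * w b * (∫ t, e a b t ∂P n + γ a b) := by
        rw [integral_finsetSum _ fun a _ => integrable_finsetSum _ fun b _ => hri a b]
        refine Finset.sum_congr rfl fun a _ => ?_
        rw [integral_finsetSum _ fun b _ => hri a b]
        refine Finset.sum_congr rfl fun b _ => ?_
        rw [integral_const_mul, integral_add (hei n a b) (integrable_const _)]
        simp
    _ ≤ ε := hn.le

end Pairing

/-! ### Relative independence of the translates, by induction on their number -/

section Averages

open scoped ComplexConjugate InnerProductSpace

variable {R G X Y : Type*} [Ring R] [AddCommGroup G] [Module R G]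
  (𝒳' : MeasurableSpace X) [𝒳 : MeasurableSpace X] [StandardBorelSpace X] [Nonempty X]
  [AddAction G X] {μ : Measure X} [IsProbabilityMeasure μ] [𝒴 : MeasurableSpace Y] [AddAction G Y]
  {π : X → Y} {ν : Measure Y} (hπ : IsFactorMap G 𝒳' μ ν π) {l : ℕ}

include hπ in
/-- The product of fibrewise means is a function of `π`, so the fixed factor may be replaced by its
fibrewise mean; this bounds the integral by the mean square of that fibrewise mean. -/
theorem norm_integral_mul_translateProd_condMean_le [MeasurableConstVAdd G Y]
    {T : Fin l → G} {a : X → ℂ} (ha : Measurable a)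
    {F : Fin l → X → ℂ} (hF : ∀ i, Measurable (F i)) {D : ℝ} (haD : ∀ x, ‖a x‖ ≤ D)
    (hFD : ∀ i x, ‖F i x‖ ≤ D) {δ : ℝ} (hδ : 0 < δ) (t : R) :
    ‖∫ ω, a ω * translateProd T (fun i => condMean μ π (F i)) t ω ∂μ‖ ≤
      D ^ l * (δ + (∫ ω, ‖condMean μ π a ω‖ ^ 2 ∂μ) / δ) := by
  have hπm : Measurable π := hπ.measurable.mono hπ.le le_rfl
  have hb : ∀ ω, ‖translateProd T (fun i => condMean μ π (F i)) t ω‖ ≤ D ^ l :=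
    norm_translateProd_le T (fun i => norm_condMean_le (hFD i)) t
  have hEm : Measurable (condMean μ π a) := (measurable_condMean ha).mono hπm.comap_le le_rfl
  have hEi := integrable_of_bounded (μ := μ) hEm (norm_condMean_le haD)
  have hE2 : Integrable (fun ω => ‖condMean μ π a ω‖ ^ 2) μ :=
    .of_bound (hEm.norm.pow_const 2).aestronglyMeasurable (D ^ 2) (ae_of_all _ fun ω => by
      rw [norm_pow, norm_norm]
      exact pow_le_pow_left₀ (norm_nonneg _) (norm_condMean_le haD ω) 2)
  have hprod : ∀ s : Finset (Fin l), AEStronglyMeasurable[𝒴.comap π]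
      (fun ω => ∏ i ∈ s, condMean μ π (F i) ((t • T i) +ᵥ ω)) μ := fun s => by
    induction s using Finset.induction_on with
    | empty => exact stronglyMeasurable_const.aestronglyMeasurable
    | insert i s hi ih =>
      simp only [Finset.prod_insert hi]
      exact (aestronglyMeasurable_comap_vadd _ (hπ.equivariant _)
        (measurable_integral_condDistrib_id (π := π) (μ := μ) (hF i))).mul ih
  have hcomap : AEStronglyMeasurable[𝒴.comap π]
      (translateProd T (fun i => condMean μ π (F i)) t) μ :=
    hprod Finset.univ
  have h1 := integral_mul_condMean hπm (integrable_of_bounded ha haD) hcomap hb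
  simp_rw [mul_comm (a _)]
  rw [← h1]
  simp_rw [mul_comm _ (condMean μ π a _)]
  have hD0 : 0 ≤ D ^ l :=
    pow_nonneg ((norm_nonneg _).trans (haD (Classical.arbitrary X))) l
  refine (norm_integral_mul_le hEi hb).trans (mul_le_mul_of_nonneg_left ?_ hD0)
  have h2 : ∫ ω, ‖condMean μ π a ω‖ ∂μ ≤ ∫ ω, (δ + ‖condMean μ π a ω‖ ^ 2 / δ) ∂μ := by
    refine integral_mono hEi.norm ((integrable_const δ).add (hE2.div_const δ)) fun ω => ?_
    set y := ‖condMean μ π a ω‖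
    show y ≤ δ + y ^ 2 / δ
    rw [← sub_nonneg, show δ + y ^ 2 / δ - y = ((y - δ / 2) ^ 2 + 3 / 4 * δ ^ 2) / δ by
      field_simp; ring]
    positivity
  rw [integral_add (integrable_const δ) (hE2.div_const δ), integral_div] at h2
  simpa using h2

include hπ in
/-- An autocorrelation of a product of `l + 1` translates is controlled by the error made for a
product of `l` translates and by the fibrewise correlations of any one factor. -/
theorem norm_integral_conj_translateProd_mul_le [MeasurableConstVAdd G X]
    [VAddInvariantMeasure G X μ] [MeasurableConstVAdd G Y] {T : Fin (l + 1) → G}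
    {f : Fin (l + 1) → X → ℂ} {C : ℝ} (hf : ∀ i, Measurable (f i))
    (hC : ∀ i x, ‖f i x‖ ≤ C) (j : Fin (l + 1)) (s r t : R)
    {δ : ℝ} (hδ : 0 < δ) {T' : Fin l → G} (hT' : T' = fun k => T (j.succAbove k) - T j)
    {c : Fin (l + 1) → X → ℂ}
    (hc : c = fun i => translateCorrelation (f i) (s • T i) (r • T i)) :
    ‖∫ ω, conj (translateProd T f (t + s) ω) * translateProd T f (t + r) ω ∂μ‖ ≤
      ‖∫ ω, c j ω * (translateProd T' (fun k => c (j.succAbove k)) t ω -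
        translateProd T' (fun k => condMean μ π (c (j.succAbove k))) t ω) ∂μ‖ +
      (C * C) ^ l * (δ + (∫ ω, ‖condMean μ π (c j) ω‖ ^ 2 ∂μ) / δ) := by
  have hπm : Measurable π := hπ.measurable.mono hπ.le le_rfl
  have hcm : ∀ i, Measurable (c i) := fun i => by
    rw [hc]
    exact measurable_translateCorrelation (hf i) measurable_const_vadd _ _
  have hcC : ∀ i x, ‖c i x‖ ≤ C * C := fun i => by
    rw [hc]
    exact norm_translateCorrelation_le (hC i) _ _
  have hEm : ∀ i, Measurable (condMean μ π (c i)) := fun i =>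
    (measurable_condMean (hcm i)).mono hπm.comap_le le_rfl
  have hint : ∀ {q : Fin l → X → ℂ}, (∀ k, Measurable (q k)) → (∀ k x, ‖q k x‖ ≤ C * C) →
      Integrable (fun ω => c j ω * translateProd T' q t ω) μ := fun {q} hq hqC =>
    (integrable_of_bounded (hcm j) (hcC j)).mul_bdd (c := (C * C) ^ l)
      (measurable_translateProd T' hq measurable_const_vadd t).aestronglyMeasurable
      (ae_of_all _ (norm_translateProd_le T' hqC t))
  have h0 : ∫ ω, conj (translateProd T f (t + s) ω) * translateProd T f (t + r) ω ∂μ =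
      ∫ ω, c j ω * translateProd T' (fun k => c (j.succAbove k)) t ω ∂μ := by
    rw [integral_conj_translateProd_mul f j s r t, hc, hT']
  have h1 : ∫ ω, c j ω * translateProd T' (fun k => c (j.succAbove k)) t ω ∂μ =
      ∫ ω, c j ω * (translateProd T' (fun k => c (j.succAbove k)) t ω -
        translateProd T' (fun k => condMean μ π (c (j.succAbove k))) t ω) ∂μ +
      ∫ ω, c j ω * translateProd T' (fun k => condMean μ π (c (j.succAbove k))) t ω ∂μ := by
    simp only [mul_sub]
    rw [integral_sub (hint (fun k => hcm _) fun k => hcC _)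
      (hint (fun k => hEm _) fun k => norm_condMean_le (hcC _)), sub_add_cancel]
  rw [h0, h1]
  exact (norm_add_le _ _).trans (add_le_add le_rfl
    (norm_integral_mul_translateProd_condMean_le 𝒳' hπ (hcm j) (fun k => hcm _) (hcC j)
      (fun k => hcC _) hδ t))

variable [TopologicalSpace R] [MeasurableSpace R] [BorelSpace R]
  [TopologicalSpace G] [MeasurableSpace G] [BorelSpace G] [ContinuousSMul R G]
  [MeasurableVAdd₂ G X] {P : ℕ → Measure R} [∀ n, IsProbabilityMeasure (P n)]

include hπ in
/-- The factors `f i` are replaced by their fibrewise means one at a time; each replacement costs a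
product of translates one of whose factors has mean zero on the fibres. -/
theorem hasRelativelyIndependentTranslates_of_tendsto
    (h : ∀ T : Fin l → G, Function.Injective T → (∀ i, T i ≠ 0) → ∀ (f : Fin l → X → ℂ) (C : ℝ),
      (∀ i, Measurable[𝒳'] (f i)) → (∀ i x, ‖f i x‖ ≤ C) → ∀ j, condMean μ π (f j) =ᵐ[μ] 0 →
      ∀ φ : X → ℂ, MemLp φ 2 μ →
      Tendsto (fun n => ∫ t, ‖∫ ω, φ ω * translateProd T f t ω ∂μ‖ ∂P n) atTop (𝓝 0)) :
    HasRelativelyIndependentTranslates (G := G) 𝒳' μ π P l := by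
  intro T hT hT0 f C hf hC φ hφ hφ2
  have hπm : Measurable π := hπ.measurable.mono hπ.le le_rfl
  have hφi : Integrable φ μ := hφ2.integrable one_le_two
  set E : Fin l → X → ℂ := fun i => condMean μ π (f i) with hE
  have hEm : ∀ i, Measurable[𝒳'] (E i) := fun i =>
    (measurable_condMean ((hf i).mono hπ.le le_rfl)).mono hπ.measurable.comap_le le_rfl
  have hEC : ∀ i x, ‖E i x‖ ≤ C := fun i => norm_condMean_le (hC i)
  have key : ∀ s : Finset (Fin l), Tendsto (fun n => ∫ t, ‖∫ ω, φ ω * (translateProd T f t ω -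
      translateProd T (s.piecewise E f) t ω) ∂μ‖ ∂P n) atTop (𝓝 0) := by
    intro s
    induction s using Finset.induction_on with
    | empty => simp
    | insert j s hjs ih =>
      set g : Fin l → X → ℂ := s.piecewise E f with hg
      set k : Fin l → X → ℂ := Function.update g j fun x => g j x - E j x with hk
      have hgj : g j = f j := Finset.piecewise_eq_of_notMem _ _ _ hjs
      have hC0 : 0 ≤ C := (norm_nonneg _).trans (hC j (Classical.arbitrary X))
      have hgm : ∀ i, Measurable[𝒳'] (g i) := fun i => by
        by_cases hi : i ∈ s
        · rw [hg, Finset.piecewise_eq_of_mem _ _ _ hi]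
          exact hEm i
        · rw [hg, Finset.piecewise_eq_of_notMem _ _ _ hi]
          exact hf i
      have hgC : ∀ i x, ‖g i x‖ ≤ C := fun i => by
        by_cases hi : i ∈ s
        · rw [hg, Finset.piecewise_eq_of_mem _ _ _ hi]
          exact hEC i
        · rw [hg, Finset.piecewise_eq_of_notMem _ _ _ hi]
          exact hC i
      have hkm : ∀ i, Measurable[𝒳'] (k i) := fun i => by
        by_cases hi : i = j
        · subst hi
          rw [hk, Function.update_self]
          exact Measurable.sub (hgm i) (hEm i)
        · rw [hk, Function.update_of_ne hi]
          exact hgm i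
      have hkC : ∀ i x, ‖k i x‖ ≤ C + C := fun i x => by
        by_cases hi : i = j
        · subst hi
          rw [hk, Function.update_self]
          exact (norm_sub_le _ _).trans (add_le_add (hgC i x) (hEC i x))
        · rw [hk, Function.update_of_ne hi]
          exact (hgC i x).trans (le_add_of_nonneg_left hC0)
      have hkj : condMean μ π (k j) =ᵐ[μ] 0 := by
        rw [hk, Function.update_self, hgj]
        exact condMean_sub_condMean hπm ((hf j).mono hπ.le le_rfl) (hC j)
      have hlim := ih.add (h T hT hT0 k _ hkm hkC j hkj φ hφ2)
      rw [add_zero] at hlim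
      have hmeas : ∀ {q : Fin l → X → ℂ}, (∀ i, Measurable[𝒳'] (q i)) →
          Measurable (Function.uncurry (translateProd (R := R) T q)) := fun hq =>
        measurable_uncurry_translateProd T fun i => (hq i).mono hπ.le le_rfl
      have hbf := norm_translateProd_le (R := R) T hC
      have hbg := norm_translateProd_le (R := R) T hgC
      have hbk := norm_translateProd_le (R := R) T hkC
      have hdm := (hmeas hf).sub (hmeas hgm)
      have hdb : ∀ (t : R) ω, ‖translateProd T f t ω - translateProd T g t ω‖ ≤ C ^ l + C ^ l :=
        fun t ω => (norm_sub_le _ _).trans (add_le_add (hbf t ω) (hbg t ω))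
      have hprod : ∀ {u : X → ℂ} {D : ℝ}, Measurable u → (∀ ω, ‖u ω‖ ≤ D) →
          Integrable (fun ω => φ ω * u ω) μ := fun {u D} hu hD =>
        hφi.mul_bdd (c := D) hu.aestronglyMeasurable (ae_of_all _ hD)
      refine squeeze_zero (fun n => integral_nonneg fun t => norm_nonneg _) (fun n => ?_) hlim
      have hi1 := integrable_norm_integral_mul (P := P n) hφ hφi
        (u := fun t ω => translateProd T f t ω - translateProd T g t ω) hdm hdb
      have hi2 := integrable_norm_integral_mul (P := P n) hφ hφi (hmeas hkm) hbk
      rw [← integral_add hi1 hi2]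
      refine integral_mono_of_nonneg (ae_of_all _ fun t => norm_nonneg _) (hi1.add hi2)
        (ae_of_all _ fun t => ?_)
      have hsplit : ∀ ω, φ ω * (translateProd T f t ω -
          translateProd T ((insert j s).piecewise E f) t ω) =
          φ ω * (translateProd T f t ω - translateProd T g t ω) + φ ω * translateProd T k t ω := by
        intro ω
        rw [Finset.piecewise_insert, ← mul_add, hk, ← translateProd_sub_update]
        ring
      simp only [hsplit]
      rw [integral_add (hprod (u := fun ω => translateProd T f t ω - translateProd T g t ω)
          (hdm.comp measurable_prodMk_left) (hdb t))
        (hprod (u := translateProd T k t) ((hmeas hkm).comp measurable_prodMk_left) (hbk t))]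
      exact norm_add_le _ _
  simpa using key Finset.univ

variable [VAddInvariantMeasure G X μ] [MeasurableConstVAdd G Y]

include hπ in
/-- A product of `l + 1` translates tends weakly to `0` on average if one of the functions has mean
zero on the fibres and products of `l` translates are relatively independent on average. -/
theorem tendsto_average_translateProd [MeasurableAdd R] (hP : AsymptoticallyInvariant P)
    (hwm : IsTotallyRelativelyWeakMixing R 𝒳' μ π (Set.univ : Set G))
    (hl : HasRelativelyIndependentTranslates (G := G) 𝒳' μ π P l) {T : Fin (l + 1) → G}
    (hT : Function.Injective T) (hT0 : ∀ i, T i ≠ 0) {f : Fin (l + 1) → X → ℂ} {C : ℝ}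
    (hf : ∀ i, Measurable[𝒳'] (f i)) (hC : ∀ i x, ‖f i x‖ ≤ C) {j : Fin (l + 1)}
    (hj : condMean μ π (f j) =ᵐ[μ] 0) {φ : X → ℂ} (hφ2 : MemLp φ 2 μ) :
    Tendsto (fun n => ∫ t, ‖∫ ω, φ ω * translateProd T f t ω ∂μ‖ ∂P n) atTop (𝓝 0) := by
  have hπm : Measurable π := hπ.measurable.mono hπ.le le_rfl
  have hfm : ∀ i, Measurable (f i) := fun i => (hf i).mono hπ.le le_rfl
  have hC0 : 0 ≤ C := (norm_nonneg _).trans (hC 0 (Classical.arbitrary X))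
  have hum := measurable_uncurry_translateProd (R := R) T hfm
  have hub : ∀ t : R, ∀ ω, ‖translateProd T f t ω‖ ≤ C ^ (l + 1) := norm_translateProd_le T hC
  have hu2 : ∀ t : R, MemLp (translateProd T f t) 2 μ := fun t =>
    MemLp.of_bound (hum.comp measurable_prodMk_left).aestronglyMeasurable _ (ae_of_all _ (hub t))
  set x : R → Lp ℂ 2 μ := fun t => (hu2 t).toLp (translateProd T f t) with hx
  have hxm : StronglyMeasurable x := stronglyMeasurable_toLp hum hu2
  have hxC : ∀ t, ‖x t‖ ≤ C ^ (l + 1) := fun t => by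
    have := Lp.norm_le_of_ae_bound (f := x t) (pow_nonneg hC0 (l + 1)) (by
      filter_upwards [(hu2 t).coeFn_toLp] with ω hω
      rw [hx, hω]
      exact hub t ω)
    simpa [measureUnivNNReal] using this
  have hφc : MemLp (fun ω => conj (φ ω)) 2 μ := hφ2.star
  have hpair : ∀ t, ⟪hφc.toLp _, x t⟫_ℂ = ∫ ω, φ ω * translateProd T f t ω ∂μ := fun t => by
    rw [hx, inner_toLp_eq_integral]
    simp
  have hmain := tendsto_average_norm_inner hP hxm hxC (fun ε hε => ?_) (hφc.toLp _)
  · simpa only [hpair] using hmain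
  -- `δ` makes both the constant term `M * δ` and, with weights for `δ * δ`, the term in `γ / δ`
  -- at most `ε / 3`.
  set M : ℝ := (C * C) ^ l with hM
  have hM0 : 0 ≤ M := pow_nonneg (mul_nonneg hC0 hC0) l
  set δ : ℝ := ε / (3 * (M + 1)) with hδ
  have hδ0 : 0 < δ := by positivity
  have hMδ : M * δ ≤ ε / 3 := by
    rw [hδ, ← mul_div_assoc, div_le_div_iff₀ (by positivity) (by positivity)]
    nlinarith
  obtain ⟨ι, _, w, r, hw0, hw1, hγ⟩ := IsRelativelyWeakMixingFor.exists_weights 𝒳' hπ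
    (hwm (T j) (Set.mem_univ _) (hT0 j)) (hf j) (hC j) hj (ε := δ * δ) (by positivity)
  refine ⟨ι, inferInstance, w, r, hw0, hw1, ?_⟩
  set T' : Fin l → G := fun k => T (j.succAbove k) - T j with hT'
  set c : ι → ι → Fin (l + 1) → X → ℂ := fun a b i =>
    translateCorrelation (f i) (r a • T i) (r b • T i) with hc
  have hcm' : ∀ a b i, Measurable[𝒳'] (c a b i) := fun a b i =>
    @measurable_translateCorrelation G X _ 𝒳' _ (hf i) hπ.invariant _ _
  have hcm : ∀ a b i, Measurable (c a b i) := fun a b i => (hcm' a b i).mono hπ.le le_rfl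
  have hcC : ∀ a b i ω, ‖c a b i ω‖ ≤ C * C := fun a b i =>
    norm_translateCorrelation_le (hC i) _ _
  have hEm : ∀ a b i, Measurable (condMean μ π (c a b i)) := fun a b i =>
    (measurable_condMean (hcm a b i)).mono hπm.comap_le le_rfl
  set γ : ι → ι → ℝ := fun a b => ∫ ω, ‖condMean μ π (c a b j) ω‖ ^ 2 ∂μ with hγdef
  set e : ι → ι → R → ℝ := fun a b t => ‖∫ ω, c a b j ω *
    (translateProd T' (fun k => c a b (j.succAbove k)) t ω -
      translateProd T' (fun k => condMean μ π (c a b (j.succAbove k))) t ω) ∂μ‖ with he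
  have hei : ∀ n a b, Integrable (e a b) (P n) := fun n a b => by
    refine integrable_norm_integral_mul (D := M + M) (hcm a b j)
      (integrable_of_bounded (hcm a b j) (hcC a b j))
      ((measurable_uncurry_translateProd T' fun k => hcm _ _ _).sub
        (measurable_uncurry_translateProd T' fun k => hEm _ _ _)) fun t ω => ?_
    exact (norm_sub_le _ _).trans (add_le_add (norm_translateProd_le T' (fun k => hcC _ _ _) t ω)
      (norm_translateProd_le T' (fun k => norm_condMean_le (hcC _ _ _)) t ω))
  have helim : ∀ a b, Tendsto (fun n => ∫ t, e a b t ∂P n) atTop (𝓝 0) := fun a b =>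
    hl T' (fun k k' hkk => Fin.succAbove_right_injective (hT (sub_left_injective hkk)))
      (fun k hk => Fin.succAbove_ne j k (hT (sub_eq_zero.1 hk)))
      (fun k => c a b (j.succAbove k)) (C * C) (fun k => hcm' _ _ _) (fun k => hcC _ _ _) _
      (hcm _ _ _) (MemLp.of_bound (hcm a b j).aestronglyMeasurable _ (ae_of_all _ (hcC a b j)))
  refine eventually_average_sum_le (e := e) (γ := fun a b => M * (δ + γ a b / δ)) hw0
    (fun a b t => norm_nonneg _) (fun a b t => ?_) hei helim ?_
  · rw [hx, inner_toLp_eq_integral]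
    exact norm_integral_conj_translateProd_mul_le 𝒳' hπ hfm hC j (r a) (r b) t hδ0 hT' rfl
  · have hww : ∑ a, ∑ b, w a * w b = 1 := by
      simp_rw [← Finset.mul_sum, hw1, mul_one, hw1]
    have h1 : ∑ a, ∑ b, w a * w b * (M * (δ + γ a b / δ)) =
        M * δ + M / δ * ∑ a, ∑ b, w a * w b * γ a b := by
      calc ∑ a, ∑ b, w a * w b * (M * (δ + γ a b / δ))
          = M * δ * (∑ a, ∑ b, w a * w b) + M / δ * ∑ a, ∑ b, w a * w b * γ a b := by
            simp only [Finset.mul_sum, ← Finset.sum_add_distrib]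
            refine Finset.sum_congr rfl fun a _ => Finset.sum_congr rfl fun b _ => ?_
            ring
        _ = _ := by rw [hww, mul_one]
    have h2 : M / δ * ∑ a, ∑ b, w a * w b * γ a b ≤ M / δ * (δ * δ) :=
      mul_le_mul_of_nonneg_left hγ (by positivity)
    have h3 : M / δ * (δ * δ) = M * δ := by field_simp
    rw [h1]
    linarith

include hπ in
theorem hasRelativelyIndependentTranslates [MeasurableAdd R] (hP : AsymptoticallyInvariant P)
    (hwm : IsTotallyRelativelyWeakMixing R 𝒳' μ π (Set.univ : Set G)) (l : ℕ) :
    HasRelativelyIndependentTranslates (G := G) 𝒳' μ π P l := by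
  induction l with
  | zero =>
    exact hasRelativelyIndependentTranslates_of_tendsto (P := P) 𝒳' hπ
      fun _ _ _ _ _ _ _ j => j.elim0
  | succ l ih =>
    exact hasRelativelyIndependentTranslates_of_tendsto (P := P) 𝒳' hπ
      fun T hT hT0 f C hf hC j hj φ hφ2 =>
        tendsto_average_translateProd 𝒳' hπ hP hwm ih hT hT0 hf hC hj hφ2

end Averages

/-! ### Convergence in density for the weak topology -/

section Density

/-- The filter of the sets whose complement has density `0` over `F`. -/
def densityFilter {R : Type*} [MeasurableSpace R] (lam : Measure R) (F : ℕ → Set R) : Filter R :=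
  Filter.comk (fun S => Tendsto (fun n => lam (S ∩ F n) / lam (F n)) atTop (𝓝 0))
    (by simp)
    (fun _ hT _ hST => tendsto_of_tendsto_of_tendsto_of_le_of_le tendsto_const_nhds hT
      (fun _ => zero_le) fun _ =>
        ENNReal.div_le_div_right (measure_mono (Set.inter_subset_inter_left _ hST)) _)
    (fun S hS T hT => by
      have h := hS.add hT
      rw [add_zero] at h
      refine tendsto_of_tendsto_of_tendsto_of_le_of_le tendsto_const_nhds h
        (fun _ => zero_le) fun n => ?_
      simp only [← ENNReal.add_div, Set.union_inter_distrib_right]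
      exact ENNReal.div_le_div_right (measure_union_le _ _) _)

theorem mem_densityFilter {R : Type*} [MeasurableSpace R] {lam : Measure R} {F : ℕ → Set R}
    {S : Set R} : S ∈ densityFilter lam F ↔
      Tendsto (fun n => lam (Sᶜ ∩ F n) / lam (F n)) atTop (𝓝 0) :=
  Iff.rfl

theorem convergesInDensity_of_tendsto {R E : Type*} [MeasurableSpace R] [TopologicalSpace E]
    {lam : Measure R} {F : ℕ → Set R} {x : R → E} {a : E} (hx : Measurable[_, borel E] x)
    (h : Tendsto x (densityFilter lam F) (𝓝 a)) : ConvergesInDensity lam F x a := by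
  refine ⟨hx, fun V hV => ?_⟩
  have h1 : Tendsto (fun n => lam ({t | x t ∉ V} ∩ F n) / lam (F n)) atTop (𝓝 0) :=
    mem_densityFilter.1 (h hV)
  exact h1.limsup_eq

theorem tendsto_toWeakSpace {ι 𝕜 E : Type*} [CommSemiring 𝕜] [TopologicalSpace 𝕜]
    [ContinuousAdd 𝕜] [ContinuousConstSMul 𝕜 𝕜] [AddCommMonoid E] [Module 𝕜 E]
    [TopologicalSpace E] {l : Filter ι} {f : ι → E} {x : E}
    (h : ∀ ψ : StrongDual 𝕜 E, Tendsto (fun i => ψ (f i)) l (𝓝 (ψ x))) :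
    Tendsto (fun i => toWeakSpace 𝕜 E (f i)) l (𝓝 (toWeakSpace 𝕜 E x)) :=
  have hi : IsInducing fun (z : WeakSpace 𝕜 E) (ψ : StrongDual 𝕜 E) =>
      ψ ((toWeakSpace 𝕜 E).symm z) := ⟨rfl⟩
  hi.tendsto_nhds_iff.2 (tendsto_pi_nhds.2 h)

theorem exists_bounded_measurable_ae_eq {X : Type*} {m m0 : MeasurableSpace X} {μ : Measure X}
    {f : X → ℂ} (hf : MemLp f ⊤ μ) (hf' : AEStronglyMeasurable[m] f μ) :
    ∃ (g : X → ℂ) (C : ℝ), 0 ≤ C ∧ Measurable[m] g ∧ (∀ x, ‖g x‖ ≤ C) ∧ f =ᵐ[μ] g := by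
  set C : ℝ := (eLpNorm f ⊤ μ).toReal
  have hbound : ∀ᵐ x ∂μ, ‖f x‖ ≤ C := by
    filter_upwards [ae_le_eLpNormEssSup (f := f) (μ := μ)] with x hx
    rw [← toReal_enorm]
    exact ENNReal.toReal_mono hf.2.ne (by rwa [eLpNorm_exponent_top])
  have hmk : Measurable[m] (hf'.mk f) := hf'.stronglyMeasurable_mk.measurable
  have hs : MeasurableSet[m] {x | ‖hf'.mk f x‖ ≤ C} := measurable_norm.comp hmk measurableSet_Iic
  refine ⟨{x | ‖hf'.mk f x‖ ≤ C}.indicator (hf'.mk f), C, ENNReal.toReal_nonneg,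
    hmk.indicator hs, fun x => ?_, ?_⟩
  · by_cases h : x ∈ {x | ‖hf'.mk f x‖ ≤ C}
    · rw [Set.indicator_of_mem h]
      exact h
    · rw [Set.indicator_of_notMem h, norm_zero]
      exact ENNReal.toReal_nonneg
  · filter_upwards [hbound, hf'.ae_eq_mk] with x h1 h2
    have h : x ∈ {x | ‖hf'.mk f x‖ ≤ C} := by
      rw [Set.mem_ofPred_eq, ← h2]
      exact h1
    rw [Set.indicator_of_mem h, h2]

end Density

open scoped ComplexConjugate in
theorem proposition3p7
    {R G X Y : Type*}
    -- the ring `R` and the locally compact second countable `R`-module `G`, written additively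
    [Ring R] [TopologicalSpace R] [IsTopologicalAddGroup R] [LocallyCompactSpace R]
    [SecondCountableTopology R] [T2Space R] [MeasurableSpace R] [BorelSpace R]
    [AddCommGroup G] [TopologicalSpace G] [IsTopologicalAddGroup G] [LocallyCompactSpace G]
    [SecondCountableTopology G] [T2Space G] [MeasurableSpace G] [BorelSpace G]
    [Module R G] [ContinuousSMul R G]
    (lam : Measure R) [lam.IsAddHaarMeasure]
    -- the sub-σ-algebra `𝒳'` and the standard Borel `G`-space `(X, 𝒳, μ)`
    (𝒳' : MeasurableSpace X) [𝒳 : MeasurableSpace X] [StandardBorelSpace X] [Nonempty X]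
    [AddAction G X] [MeasurableVAdd₂ G X]
    (μ : Measure X) [IsProbabilityMeasure μ] [VAddInvariantMeasure G X μ]
    -- the factor `(Y, 𝒴, ν)`
    [MeasurableSpace Y] [AddAction G Y] [MeasurableConstVAdd G Y]
    (ν : Measure Y) [IsProbabilityMeasure ν] [VAddInvariantMeasure G Y ν]
    (π : X → Y) (hπ : IsFactorMap G 𝒳' μ ν π)
    (hwm : IsTotallyRelativelyWeakMixing R 𝒳' μ π (Set.univ : Set G))
    (l : ℕ) (T : Fin l → G) (hT : Function.Injective T) (hT0 : ∀ i, T i ≠ 0)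
    (f : Fin l → X → ℂ) (hf : ∀ i, MemLp (f i) ⊤ μ)
    (hf' : ∀ i, AEStronglyMeasurable[𝒳'] (f i) μ)
    (F : ℕ → Set R) (hF : IsWeakFolner lam F) :
    ∃ x : R → lpMeas ℂ ℂ 𝒳' 2 μ,
      (∀ t : R, ((x t : Lp ℂ 2 μ) : X → ℂ) =ᵐ[μ] fun ω =>
        ∏ i, f i ((t • T i) +ᵥ ω) -
          ∏ i, (μ[f i | MeasurableSpace.comap π inferInstance]) ((t • T i) +ᵥ ω)) ∧
      ConvergesInDensity lam F (fun t => toWeakSpace ℂ (lpMeas ℂ ℂ 𝒳' 2 μ) (x t)) 0 := by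
  have hπm : Measurable π := hπ.measurable.mono hπ.le le_rfl
  choose g C hC0 hg hgC hfg using fun i => exists_bounded_measurable_ae_eq (hf i) (hf' i)
  set D : ℝ := ∑ i, C i with hD
  have hgD : ∀ i x, ‖g i x‖ ≤ D := fun i x =>
    (hgC i x).trans (Finset.single_le_sum (fun i _ => hC0 i) (Finset.mem_univ i))
  have hgm : ∀ i, Measurable (g i) := fun i => (hg i).mono hπ.le le_rfl
  set E : Fin l → X → ℂ := fun i => condMean μ π (g i) with hE
  have hEm' : ∀ i, Measurable[𝒳'] (E i) := fun i =>
    (measurable_condMean (hgm i)).mono hπ.measurable.comap_le le_rfl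
  have hEm : ∀ i, Measurable (E i) := fun i => (hEm' i).mono hπ.le le_rfl
  have hED : ∀ i x, ‖E i x‖ ≤ D := fun i => norm_condMean_le (hgD i)
  set u : R → X → ℂ := fun t ω => translateProd T g t ω - translateProd T E t ω with hu
  have hum : Measurable (Function.uncurry u) :=
    (measurable_uncurry_translateProd T hgm).sub (measurable_uncurry_translateProd T hEm)
  have huD : ∀ t ω, ‖u t ω‖ ≤ D ^ l + D ^ l := fun t ω =>
    (norm_sub_le _ _).trans (add_le_add (norm_translateProd_le T hgD t ω)
      (norm_translateProd_le T hED t ω))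
  have hu2 : ∀ t, MemLp (u t) 2 μ := fun t =>
    MemLp.of_bound (hum.comp measurable_prodMk_left).aestronglyMeasurable _ (ae_of_all _ (huD t))
  have hum' : ∀ t, Measurable[𝒳'] (u t) := fun t =>
    Measurable.sub (@measurable_translateProd R G X _ _ _ _ l 𝒳' T g hg hπ.invariant t)
      (@measurable_translateProd R G X _ _ _ _ l 𝒳' T E hEm' hπ.invariant t)
  have hmem : ∀ t, (hu2 t).toLp (u t) ∈ lpMeas ℂ ℂ 𝒳' 2 μ := fun t => by
    rw [mem_lpMeas_iff_aestronglyMeasurable]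
    exact (hum' t).stronglyMeasurable.aestronglyMeasurable.congr (hu2 t).coeFn_toLp.symm
  refine ⟨fun t => ⟨(hu2 t).toLp (u t), hmem t⟩, fun t => ?_, convergesInDensity_of_tendsto ?_ ?_⟩
  · have h1 : ∀ᵐ ω ∂μ, ∀ i, f i ((t • T i) +ᵥ ω) = g i ((t • T i) +ᵥ ω) :=
      ae_all_iff.2 fun i =>
        (measurePreserving_vadd (t • T i) μ).quasiMeasurePreserving.ae (hfg i)
    have h2 : ∀ᵐ ω ∂μ, ∀ i, (μ[f i | MeasurableSpace.comap π inferInstance]) ((t • T i) +ᵥ ω) =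
        E i ((t • T i) +ᵥ ω) :=
      ae_all_iff.2 fun i => (measurePreserving_vadd (t • T i) μ).quasiMeasurePreserving.ae
        ((condExp_congr_ae (hfg i)).trans
          (condMean_ae_eq hπm (integrable_of_bounded (hgm i) (hgD i))).symm)
    filter_upwards [(hu2 t).coeFn_toLp, h1, h2] with ω h0 h1 h2
    simp only [h1, h2]
    exact h0
  · let _ : MeasurableSpace (Lp ℂ 2 μ) := borel _
    have : BorelSpace (Lp ℂ 2 μ) := ⟨rfl⟩
    have h1 : Measurable fun t => (hu2 t).toLp (u t) := (stronglyMeasurable_toLp hum hu2).measurable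
    have h2 : Measurable fun t => (⟨_, hmem t⟩ : lpMeas ℂ ℂ 𝒳' 2 μ) := h1.subtype_mk
    have h3 := (toWeakSpaceCLM ℂ (lpMeas ℂ ℂ 𝒳' 2 μ)).continuous.borel_measurable
    rw [← BorelSpace.measurable_eq (α := lpMeas ℂ ℂ 𝒳' 2 μ)] at h3
    exact h3.comp h2
  · rw [← map_zero (toWeakSpace ℂ (lpMeas ℂ ℂ 𝒳' 2 μ))]
    refine tendsto_toWeakSpace fun ψ => ?_
    -- The functional `ψ` is the inner product with some `v` in `L²`.
    obtain ⟨Ψ, hΨ, -⟩ := exists_extension_norm_eq (lpMeas ℂ ℂ 𝒳' 2 μ) ψ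
    set v : Lp ℂ 2 μ := (InnerProductSpace.toDual ℂ (Lp ℂ 2 μ)).symm Ψ with hv
    set φ : X → ℂ := fun ω => conj (v ω) with hφ
    have hφm : Measurable φ :=
      RCLike.continuous_conj.measurable.comp (Lp.stronglyMeasurable v).measurable
    have hφ2 : MemLp φ 2 μ := (Lp.memLp v).star
    have hψ : ∀ t, ψ ⟨_, hmem t⟩ = ∫ ω, φ ω * u t ω ∂μ := fun t => by
      rw [← hΨ, ← InnerProductSpace.toDual_symm_apply, ← hv]
      have := inner_toLp_eq_integral (Lp.memLp v) (hu2 t)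
      rwa [Lp.toLp_coeFn] at this
    have := hF.isProbabilityMeasure_cond
    have hlim := hasRelativelyIndependentTranslates (P := fun n => lam[|F n]) 𝒳' hπ
      hF.asymptoticallyInvariant_cond hwm l T hT hT0 g D hg hgD φ hφm hφ2
    rw [map_zero]
    refine Metric.tendsto_nhds.2 fun ε hε => ?_
    have hset : {t | dist (ψ ⟨_, hmem t⟩) 0 < ε}ᶜ = {t | ε ≤ ‖∫ ω, φ ω * u t ω ∂μ‖} := by
      ext t
      simp [hψ]
    refine mem_densityFilter.2 ?_
    rw [hset]
    exact hF.tendsto_measure_of_tendsto_average (measurable_integral_mul hφm hum).norm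
      (fun t => norm_nonneg _)
      (fun t => norm_integral_mul_le (hφ2.integrable one_le_two) (huD t)) hlim hε
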